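/- **Conventions.** For a group $\Gamma$, $\operatorname{rk}\Gamma$ denotes the rank of the $\mathbb{Z}$-module $\Gamma^{\mathrm{ab}}$, i.e. $\dim_{\mathbb{Q}}(\Gamma^{\mathrm{ab}}\otimes\mathbb{Q})$; this is the usual rank if $\Gamma$ is abelian. A *torus* over $\mathbb{Q}$ is a group scheme over $\mathbb{Q}$ that becomes isomorphic, as a group scheme, to $\mathbb{G}_m^n$ over $\overline{\mathbb{Q}}$ for some $n\ge 0$. For a commutative group scheme $G$ of finite type over $\mathbb{Q}$ and a prime $p$, let $G(\mathbb{Q})_f$ be the set of points of $G(\mathbb{Q})$ whose image in $G(\mathbb{Q}_p)$ lies in a compact subgroup of $G(\mathbb{Q}_p)$ (for the $p$-adic topology). For a finitely generated subgroup $\Gamma\le G(\mathbb{Q})$ contained in $G(\mathbb{Q})_f$, put $$d(G,\Gamma):=\inf_{H\le G}\bigl(\dim H+\operatorname{rk}\Gamma-\operatorname{rk}(\Gamma\cap H(\mathbb{Q}))\bigr),$$ where $H$ ranges over all subgroup schemes of $G$. **Proposition.** Let $\mathcal{T}$ be a group scheme of finite type over $\mathbb{Z}$ whose generic fiber $T:=\mathcal{T}\times_{\mathbb{Z}}\mathbb{Q}$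 is a torus. Then (a) $\mathcal{T}(\mathbb{Z})$ is a finitely generated group, and if $\mathcal{T}$ is separated over $\mathbb{Z}$, then $\mathcal{T}(\mathbb{Z})$ is abelian and $\mathcal{T}(\mathbb{Z})\to T(\mathbb{Q})$ is injective. (b) $\operatorname{rk}\mathcal{T}(\mathbb{Z})\le\dim T$. (c) Let $\Gamma\le\mathcal{T}(\mathbb{Z})$ be any subgroup, with image $\Gamma_{\mathbb{Q}}$ in $T(\mathbb{Q})$ (so $\Gamma_{\mathbb{Q}}\cong\Gamma$ if $\mathcal{T}$ is separated). Then $\Gamma_{\mathbb{Q}}$ is finitely generated and is contained in $T(\mathbb{Q})_f$ for every prime $p$, so that $d(T,\Gamma_{\mathbb{Q}})$ is defined, and $d(T,\Gamma_{\mathbb{Q}})=\operatorname{rk}\Gamma$. -/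

import Mathlib

open CategoryTheory AlgebraicGeometry MonoidalCategory CartesianMonoidalCategory
open scoped MonObj

noncomputable section

namespace TorusRank

/-- The base change of a group scheme along `S' ⟶ S` is a group scheme, with the
base-changed operations. -/
instance grpObjBaseChange {S S' : Scheme.{0}} (f : S' ⟶ S) (G : Over S) [GrpObj G] :
    GrpObj ((Over.pullback f).obj G) :=
  Functor.grpObjObj

/-- The group `G(S)` of sections of a group scheme `G` over `S`. -/
abbrev Sections {S : Scheme.{0}} (G : Over S) : Type :=
  𝟙_ (Over S) ⟶ G

/-- The group `G(B)` of `B`-valued points (over `A`) of a group scheme `G` over `Spec A`. -/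
abbrev Points {A : Type} [CommRing A] (G : Over (Spec (.of A))) (B : Type) [CommRing B]
    [Algebra A B] : Type :=
  Over.mk (Spec.map (CommRingCat.ofHom (algebraMap A B))) ⟶ G

/-- The homomorphism `G(A) → G(B)` for an `A`-algebra `B`. -/
def sectionsToPoints {A : Type} [CommRing A] (G : Over (Spec (.of A))) [GrpObj G]
    (B : Type) [CommRing B] [Algebra A B] : Sections G →* Points G B where
  toFun x := toUnit _ ≫ x
  map_one' := by simp
  map_mul' x y := by simp [MonObj.comp_mul]

/-- The homomorphism `G(S) → G_{S'}(S')`, base change of sections along `S' ⟶ S`. -/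
def sectionsBaseChange {S S' : Scheme.{0}} (f : S' ⟶ S) (G : Over S) [GrpObj G] :
    Sections G →* Sections ((Over.pullback f).obj G) where
  toFun s := Functor.LaxMonoidal.ε (Over.pullback f) ≫ (Over.pullback f).map s
  map_one' := by
    rw [Functor.map_one, MonObj.comp_one]
  map_mul' x y := by
    rw [Functor.map_mul, MonObj.comp_mul]

/-- The split torus `𝔾ₘⁿ` over `K`: the spectrum of the group algebra `K[ℤⁿ]`, with the group
law given by its Hopf algebra structure. -/
abbrev splitTorus (K : Type) [Field K] (n : ℕ) : Over (Spec (.of K)) :=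
  (Spec (.of (MonoidAlgebra K (Multiplicative (Fin n → ℤ))))).asOver (Spec (.of K))

/-- A group scheme over a field `K` is a torus if over an algebraic closure of `K` it becomes
isomorphic, as a group scheme, to `𝔾ₘⁿ` for some `n ≥ 0`. -/
def IsTorus {K : Type} [Field K] (G : Over (Spec (.of K))) [GrpObj G] : Prop :=
  ∃ (n : ℕ) (e : (Over.pullback (Spec.map (CommRingCat.ofHom
      (algebraMap K (AlgebraicClosure K))))).obj G ≅ splitTorus (AlgebraicClosure K) n),
    IsMonHom e.hom

/-- The morphism `Spec ℚ ⟶ Spec ℤ`. -/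
abbrev specRatToInt : Spec (.of ℚ) ⟶ Spec (.of ℤ) :=
  Spec.map (CommRingCat.ofHom (algebraMap ℤ ℚ))

/-- The generic fibre of a scheme over `ℤ`. -/
abbrev genericFiber (𝒯 : Over (Spec (.of ℤ))) : Over (Spec (.of ℚ)) :=
  (Over.pullback specRatToInt).obj 𝒯

/-- The homomorphism `𝒯(ℤ) → T(ℚ)`, where `T` is the generic fibre of `𝒯`. -/
abbrev toGeneric (𝒯 : Over (Spec (.of ℤ))) [GrpObj 𝒯] :
    Sections 𝒯 →* Sections (genericFiber 𝒯) :=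
  sectionsBaseChange specRatToInt 𝒯

/-- The rank of a group: the rank of its abelianization as a `ℤ`-module. For abelian groups this
is the usual rank (see `rk_eq_finrank`). -/
def rk (Γ : Type*) [Group Γ] : ℕ :=
  Module.finrank ℤ (Additive (Abelianization Γ))

theorem rk_eq_finrank (Γ : Type*) [CommGroup Γ] : rk Γ = Module.finrank ℤ (Additive Γ) :=
  LinearEquiv.finrank_eq
    (MulEquiv.toAdditive (Abelianization.equivOfComm (H := Γ)).symm).toIntLinearEquiv

/-- The `p`-adic topology on `X(ℚ_p)` for a scheme `X` over `ℚ`: it is generated by the sets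
`{x ∈ U(ℚ_p) | f(x) ∈ V}` for `U = Spec A` an affine open of `X` (embedded by `j`), `f ∈ A`, and
`V ⊆ ℚ_p` open. Equivalently, each `U(ℚ_p)` is open, and carries the coarsest topology making the
regular functions on `U` continuous. -/
instance padicTopology (X : Over (Spec (.of ℚ))) (p : ℕ) [Fact p.Prime] :
    TopologicalSpace (Points X ℚ_[p]) :=
  .generateFrom
    {W | ∃ (A : CommRingCat.{0}) (j : Spec A ⟶ X.left) (_ : IsOpenImmersion j)
      (f : A) (V : Set ℚ_[p]), IsOpen V ∧
      W = {x | ∃ φ : A ⟶ CommRingCat.of ℚ_[p], x.left = Spec.map φ ≫ j ∧ φ.hom f ∈ V}}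

/-- The set `G(ℚ)_f` of points of `G(ℚ)` whose image in `G(ℚ_p)` lies in the union `G(ℚ_p)_f` of
the compact subgroups of `G(ℚ_p)`. -/
def finitePart (G : Over (Spec (.of ℚ))) [GrpObj G] (p : ℕ) [Fact p.Prime] :
    Set (Sections G) :=
  {x | ∃ C : Subgroup (Points G ℚ_[p]),
    IsCompact (C : Set (Points G ℚ_[p])) ∧ sectionsToPoints G ℚ_[p] x ∈ C}

/-- `d(G, Γ)`: the infimum over all (closed) subgroup schemes `i : H ↪ G` of the integers
`m = dim H + rk Γ - rk (Γ ∩ H(ℚ))`. -/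
def d (G : Over (Spec (.of ℚ))) [GrpObj G] (Γ : Subgroup (Sections G)) : ℕ :=
  sInf {m : ℕ | ∃ (H : Over (Spec (.of ℚ))) (_ : GrpObj H) (i : H ⟶ G) (_ : IsMonHom i),
    IsClosedImmersion i.left ∧
    ((m + rk ↥(Γ ⊓ (IsMonHom.monoidHom i (𝟙_ (Over (Spec (.of ℚ))))).range) : ℕ) :
        WithBot ℕ∞) =
      topologicalKrullDim H.left + (rk Γ : WithBot ℕ∞)}

end TorusRank

end

/-!
Let `T` be the generic fibre of `𝒯` and `K` an algebraic closure of `ℚ`, embedded into `ℂ`. An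
isomorphism `T_K ≅ 𝔾ₘⁿ` turns a rational point of `T` into a `K`-algebra homomorphism `ev` from the
Laurent polynomial ring to `K` (`exists_eval`), and the logarithms of the absolute values of its
coordinates define a homomorphism `L : T(ℚ) → ℝⁿ` (`logMap`). Everything rests on two facts about
`L`, neither of which needs the unit theorem or any structure theory of `𝒯`.

*Finiteness.* Only finitely many points of `𝒯(ℤ)` have bounded image under `L`
(`finite_sections_of_logCoord_le`). By flat base change (`span_range_appTop_eq_top`), Laurent
polynomials are `K`-linear combinations of global functions of `𝒯`. On `𝒯(ℤ)` the latter take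
integral values, which are bounded in terms of `L`; so only finitely many `ev` occur
(`finite_bounded_algHoms`). As `𝒯` need not be separated, several sections may have the same
generic point, but only finitely many (`finite_sections_over_point`). Hence every subgroup `Γ` of
`𝒯(ℤ)`, or of its image in `T(ℚ)`, is finitely generated of rank the dimension of the span of
`L(Γ)` (`fg_and_rk_of_finite_preimages`); in particular a subgroup and its image have equal ranks.

*Dimension.* If `H` is a closed subgroup scheme of `T` and `Γ ≤ H(ℚ)`, then the dimension of the
span of `L(Γ)` is at most `dim H` (`finrank_span_logCoord_le`). Let `ℤᵐ` be the quotient of the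
character lattice `ℤⁿ` by the characters orthogonal to `L(Γ)`; then `m` is at least the dimension of
the span. Linear independence of characters shows that a Laurent polynomial vanishing on `Γ`
vanishes on the subtorus with character lattice `ℤᵐ`, so this subtorus lies in `H_K`. A chain of
`m + 1` of its primes remains strict in `H` because `T_K → T` is integral.

The bound on `rk 𝒯(ℤ)` is the case `H = T`. For `d(T, Γ)` the second fact says that
`dim H - rk (Γ ∩ H(ℚ)) ≥ 0`, with equality for the trivial subgroup scheme (`d_eq_rk`).

Finally, the points of `𝒯(ℤ)` lie in the image of `𝒯(ℤ_p)` in `T(ℚ_p)`, which is a compact subgroup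
(`toGeneric_mem_finitePart`): a finite affine cover of `𝒯` writes it as a finite union of continuous
images of spaces of ring homomorphisms to `ℤ_p`, and these are compact by Tychonoff's theorem.
-/

namespace TorusRank

/-! ### Ranks of groups with a proper homomorphism to a Euclidean space -/

/-- Finite kernels do not affect the rank. -/
theorem rk_eq_finrank_of_surjective {G : Type*} [Group G] {A : Type*} [AddCommGroup A]
    (f : G →* Multiplicative A) (hf : Function.Surjective f) (hker : (f.ker : Set G).Finite) :
    rk G = Module.finrank ℤ A := by
  let F : Additive (Abelianization G) →+ A := (Abelianization.lift f).toAdditiveLeft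
  have hF : Function.Surjective F := by
    intro a
    obtain ⟨g, hg⟩ := hf (Multiplicative.ofAdd a)
    exact ⟨Additive.ofMul (Abelianization.of g), by
      change (Abelianization.lift f (Abelianization.of g)).toAdd = a
      rw [Abelianization.lift_apply_of, hg]; rfl⟩
  let Fl : Additive (Abelianization G) →ₗ[ℤ] A := F.toIntLinearMap
  have hfin : Finite (LinearMap.ker Fl) := by
    have : Finite f.ker := hker.to_subtype
    refine Finite.of_surjective (α := f.ker)
      (fun g ↦ (⟨Additive.ofMul (Abelianization.of g.1), ?_⟩ : LinearMap.ker Fl)) ?_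
    · change (Abelianization.lift f (Abelianization.of g.1)).toAdd = 0
      rw [Abelianization.lift_apply_of, g.2]; rfl
    · rintro ⟨x, hx⟩
      obtain ⟨g, hg⟩ := QuotientGroup.mk_surjective (Additive.toMul x)
      refine ⟨⟨g, ?_⟩, Subtype.ext (congrArg Additive.ofMul hg)⟩
      have h : (Abelianization.lift f (Abelianization.of g)).toAdd = 0 :=
        (congrArg (fun y ↦ (Abelianization.lift f y).toAdd) hg).trans hx
      rw [Abelianization.lift_apply_of] at h
      exact congrArg Multiplicative.ofAdd h
  have h0 : Module.rank ℤ (LinearMap.ker Fl) = 0 := by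
    rw [rank_eq_zero_iff]
    intro x
    obtain ⟨n, hn, hx⟩ := isOfFinAddOrder_iff_nsmul_eq_zero.1 (isOfFinAddOrder_of_finite x)
    exact ⟨n, by exact_mod_cast hn.ne', by simpa using hx⟩
  rw [rk, ← (Fl.quotKerEquivOfSurjective hF).finrank_eq, Module.finrank, Module.finrank,
    ← Submodule.rank_quotient_add_rank (LinearMap.ker Fl),
    h0, add_zero]

theorem group_fg_of_surjective {G H : Type*} [Group G] [Group H] (f : G →* H)
    (hf : Function.Surjective f) (hker : (f.ker : Set G).Finite) (hH : Group.FG H) :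
    Group.FG G := by
  classical
  obtain ⟨S, hS⟩ := Group.fg_iff.1 hH
  refine Group.fg_iff.2 ⟨(Function.surjInv hf '' S) ∪ f.ker, ?_, (hS.2.image _).union hker⟩
  rw [Subgroup.closure_union, Subgroup.closure_eq, ← Subgroup.comap_map_eq, MonoidHom.map_closure,
    ← Set.image_comp, Function.RightInverse.comp_eq_id (Function.rightInverse_surjInv hf)]
  simp [hS.1]

/-- A homomorphism from a group to a Euclidean space which takes only finitely many group elements
into each ball has finite kernel and discrete image, and the `ℤ`-rank of a discrete subgroup is the
dimension of its real span. -/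
theorem fg_and_rk_of_finite_preimages {G : Type*} [Group G] {E : Type*} [NormedAddCommGroup E]
    [NormedSpace ℝ E] [FiniteDimensional ℝ E] (L : G →* Multiplicative E)
    (h : ∀ B : ℝ, {g | ‖(L g).toAdd‖ ≤ B}.Finite) :
    Group.FG G ∧ rk G = Module.finrank ℝ (Submodule.span ℝ (Set.range fun g ↦ (L g).toAdd)) := by
  have hker : (L.ker : Set G).Finite := (h 0).subset fun g hg ↦ by
    have : L g = 1 := hg
    simp [this]
  let s : Set E := Set.range fun g ↦ (L g).toAdd
  let M : Submodule ℤ E := (AddMonoidHom.range L.toAdditiveLeft).toIntSubmodule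
  have hs : (M : Set E) = s := rfl
  have hM : DiscreteTopology M := by
    have hfin : ((M : Set E) ∩ Metric.closedBall 0 1).Finite := by
      refine ((h 1).image fun g ↦ (L g).toAdd).subset ?_
      rintro _ ⟨⟨g, rfl⟩, hg⟩
      exact ⟨g, mem_closedBall_zero_iff.1 hg, rfl⟩
    refine discreteTopology_iff_isOpen_singleton_zero.mpr
      ⟨Metric.ball 0 1 \ (((M : Set E) ∩ Metric.closedBall 0 1) \ {0}),
        Metric.isOpen_ball.sdiff (hfin.subset Set.sdiff_subset).isClosed, ?_⟩
    ext x
    simp only [Set.mem_preimage, Set.mem_sdiff, Metric.mem_ball, dist_zero_right, Set.mem_inter_iff,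
      SetLike.mem_coe, x.2, Metric.mem_closedBall, true_and, Set.mem_singleton_iff, not_and,
      not_not, ZeroMemClass.coe_eq_zero]
    refine ⟨fun hx ↦ hx.2 hx.1.le, ?_⟩
    rintro rfl
    simp
  have hspan : Submodule.span ℤ s = M := by rw [← hs, Submodule.span_eq]
  have hfr : Module.finrank ℝ (Submodule.span ℝ s) = Module.finrank ℤ M := by
    have := Real.finrank_eq_int_finrank_of_discrete (s := s) (by rw [hspan]; exact hM)
    rwa [Set.finrank, Set.finrank, hspan] at this
  let f : G →* Multiplicative M :=
    AddMonoidHom.toMultiplicativeRight (α := G) L.toAdditiveLeft.rangeRestrict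
  have hf : Function.Surjective f := L.toAdditiveLeft.rangeRestrict_surjective
  have hfk : (f.ker : Set G).Finite := hker.subset fun g hg ↦ by
    have h1 : L.toAdditiveLeft.rangeRestrict (Additive.ofMul g) = 0 := hg
    exact congrArg (fun x : M ↦ Multiplicative.ofAdd x.1) h1
  refine ⟨group_fg_of_surjective f hf hfk ?_, ?_⟩
  · have : Module.Finite ℤ M := inferInstance
    have : AddGroup.FG M := Module.Finite.iff_addGroup_fg.1 this
    infer_instance
  · rw [rk_eq_finrank_of_surjective f hf hfk]
    exact hfr.symm

/-! ### Points of the split torus -/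

/-- The group algebra of `ℤⁿ` over `K`, that is, the ring of Laurent polynomials in `n` variables;
it is the coordinate ring of the split torus. -/
abbrev Laurent (K : Type) [Field K] (n : ℕ) : Type :=
  MonoidAlgebra K (Multiplicative (Fin n → ℤ))

/-- The Laurent monomial with exponent vector `x`. -/
noncomputable abbrev mono {K : Type} [Field K] {n : ℕ} (x : Fin n → ℤ) : Laurent K n :=
  MonoidAlgebra.of K _ (Multiplicative.ofAdd x)

section

variable {K : Type} [Field K] {n : ℕ}

theorem eval_mono (f : Laurent K n →ₐ[K] K) (x : Fin n → ℤ) :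
    f (mono x) = ∏ i, f (mono (Pi.single i 1)) ^ x i := by
  let F : Multiplicative (Fin n → ℤ) →* Kˣ :=
    ((f : Laurent K n →* K).comp
      (MonoidAlgebra.of K (Multiplicative (Fin n → ℤ)))).toHomUnits
  have hF : ∀ y : Fin n → ℤ, f (mono y) = F (Multiplicative.ofAdd y) := fun y ↦ rfl
  have hx : Multiplicative.ofAdd x = ∏ i, Multiplicative.ofAdd (Pi.single i (1 : ℤ)) ^ x i := by
    simp_rw [← ofAdd_zsmul]
    rw [← ofAdd_sum, ← pi_eq_sum_univ' x]
  simp_rw [hF]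
  rw [hx, map_prod F, Units.coe_prod]
  simp

theorem eval_mono_ne_zero (f : Laurent K n →ₐ[K] K) (x : Fin n → ℤ) : f (mono x) ≠ 0 := by
  have h : f (mono x) * f (mono (-x)) = 1 := by
    rw [← map_mul f, ← map_mul (MonoidAlgebra.of K _), ← ofAdd_add, add_neg_cancel, ofAdd_zero,
      map_one, map_one]
  exact left_ne_zero_of_mul_eq_one h

theorem laurent_algHom_ext {f g : Laurent K n →ₐ[K] K}
    (h : ∀ i, f (mono (Pi.single i 1)) = g (mono (Pi.single i 1))) : f = g := by
  apply MonoidAlgebra.algHom_ext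
  · intro x
    change f (mono x.toAdd) = g (mono x.toAdd)
    rw [eval_mono, eval_mono g]
    simp_rw [h]
  · exact Subsingleton.elim _ _

/-- The logarithms of the absolute values, under an embedding `σ : K → ℂ`, of the coordinates of
the `K`-point `f` of the split torus. -/
noncomputable def logCoord (σ : K →+* ℂ) (f : Laurent K n →ₐ[K] K) : Fin n → ℝ :=
  fun i ↦ Real.log ‖σ (f (mono (Pi.single i 1)))‖

theorem log_norm_eval_mono (σ : K →+* ℂ) (f : Laurent K n →ₐ[K] K) (x : Fin n → ℤ) :
    Real.log ‖σ (f (mono x))‖ = ∑ i, (x i : ℝ) * logCoord σ f i := by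
  rw [eval_mono, map_prod, norm_prod, Real.log_prod]
  · simp [logCoord, Real.log_zpow]
  · intro i _
    rw [norm_ne_zero_iff, (map_ne_zero σ)]
    exact zpow_ne_zero _ (eval_mono_ne_zero f _)

/-- A bound on the logarithmic coordinates of a point bounds the value there of every Laurent
polynomial. -/
theorem exists_bound_eval (σ : K →+* ℂ) (B : ℝ) (r : Laurent K n) :
    ∃ C : ℝ, ∀ f : Laurent K n →ₐ[K] K, ‖logCoord σ f‖ ≤ B → ‖σ (f r)‖ ≤ C := by
  induction r using MonoidAlgebra.induction_on with
  | of x =>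
    refine ⟨Real.exp (∑ i, |((x.toAdd i : ℤ) : ℝ)| * B), fun f hf ↦ ?_⟩
    change ‖σ (f (mono x.toAdd))‖ ≤ _
    rw [← Real.log_le_iff_le_exp (norm_pos_iff.2 ((map_ne_zero σ).2 (eval_mono_ne_zero f _))),
      log_norm_eval_mono]
    refine Finset.sum_le_sum fun i _ ↦ (le_abs_self _).trans ?_
    rw [abs_mul]
    exact mul_le_mul_of_nonneg_left ((norm_le_pi_norm (logCoord σ f) i).trans hf) (abs_nonneg _)
  | add x y hx hy =>
    obtain ⟨C, hC⟩ := hx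
    obtain ⟨D, hD⟩ := hy
    exact ⟨C + D, fun f hf ↦ by
      rw [map_add, map_add]
      exact (norm_add_le _ _).trans (add_le_add (hC f hf) (hD f hf))⟩
  | smul c x hx =>
    obtain ⟨C, hC⟩ := hx
    exact ⟨‖σ c‖ * C, fun f hf ↦ by
      rw [map_smul, smul_eq_mul, map_mul, norm_mul]
      exact mul_le_mul_of_nonneg_left (hC f hf) (norm_nonneg _)⟩

/-- Points of the split torus at which the functions from a subring `O` spanning the coordinate
ring take integral values are finite in number as long as their logarithmic coordinates are
bounded: each function from `O` then takes only finitely many values. -/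
theorem finite_bounded_algHoms {O : Type} [CommRing O] (ρ : O →+* Laurent K n)
    (hρ : Submodule.span K (Set.range ρ) = ⊤) (σ : K →+* ℂ) (B : ℝ) :
    {f : Laurent K n →ₐ[K] K | (∀ b, ∃ m : ℤ, f (ρ b) = m) ∧
      ‖logCoord σ f‖ ≤ B}.Finite := by
  set F := {f : Laurent K n →ₐ[K] K | (∀ b, ∃ m : ℤ, f (ρ b) = m) ∧
      ‖logCoord σ f‖ ≤ B}
  have key : ∀ r : Laurent K n, ((fun f ↦ f r) '' F).Finite := by
    intro r
    have hr : r ∈ Submodule.span K (Set.range ρ) := hρ ▸ Submodule.mem_top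
    induction hr using Submodule.span_induction with
    | mem x hx =>
      obtain ⟨b, rfl⟩ := hx
      obtain ⟨C, hC⟩ := exists_bound_eval σ B (ρ b)
      refine ((Set.finite_Icc (-⌈C⌉) ⌈C⌉).image (fun m : ℤ ↦ (m : K))).subset ?_
      rintro _ ⟨f, hf, rfl⟩
      obtain ⟨m, hm⟩ := hf.1 b
      refine ⟨m, ?_, hm.symm⟩
      have h1 := hC f hf.2
      rw [hm, map_intCast, Complex.norm_intCast] at h1
      have h2 : |m| ≤ ⌈C⌉ := by
        have := h1.trans (Int.le_ceil C)
        exact_mod_cast this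
      exact abs_le.1 h2
    | zero => exact (Set.finite_singleton 0).subset (by rintro _ ⟨f, -, rfl⟩; simp)
    | add x y _ _ hx hy =>
      refine (hx.add hy).subset ?_
      rintro _ ⟨f, hf, rfl⟩
      exact ⟨_, ⟨f, hf, rfl⟩, _, ⟨f, hf, rfl⟩, (map_add f x y).symm⟩
    | smul c x _ hx =>
      refine (hx.image (c • ·)).subset ?_
      rintro _ ⟨f, hf, rfl⟩
      exact ⟨_, ⟨f, hf, rfl⟩, (map_smul f c x).symm⟩
  refine Set.Finite.of_finite_image (f := fun f i ↦ f (mono (Pi.single i 1)))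
    ((Set.Finite.pi' fun i ↦ key (mono (Pi.single i 1))).subset ?_) ?_
  · rintro _ ⟨f, hf, rfl⟩ i
    exact ⟨f, hf, rfl⟩
  · intro f _ g _ h
    exact laurent_algHom_ext fun i ↦ congrFun h i

variable (K) in
/-- The map of Laurent polynomial rings induced by a homomorphism of exponent groups. -/
noncomputable def laurentMap {n m : ℕ} (π : (Fin n → ℤ) →+ (Fin m → ℤ)) :
    Laurent K n →+* Laurent K m :=
  MonoidAlgebra.mapDomainRingHom K (AddMonoidHom.toMultiplicative π)

theorem laurentMap_mono {n m : ℕ} (π : (Fin n → ℤ) →+ (Fin m → ℤ)) (x : Fin n → ℤ) :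
    laurentMap K π (mono x) = mono (π x) := by
  simp [laurentMap, mono]

theorem laurentMap_comp_apply {n m l : ℕ} (ρ : (Fin m → ℤ) →+ (Fin l → ℤ))
    (π : (Fin n → ℤ) →+ (Fin m → ℤ)) (r : Laurent K n) :
    laurentMap K (ρ.comp π) r = laurentMap K ρ (laurentMap K π r) := by
  have : laurentMap K (ρ.comp π) = (laurentMap K ρ).comp (laurentMap K π) := by
    rw [laurentMap, laurentMap, laurentMap, ← MonoidAlgebra.mapDomainRingHom_comp]
    rfl
  rw [this, RingHom.comp_apply]

theorem mono_injective : Function.Injective (mono : (Fin n → ℤ) → Laurent K n) :=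
  MonoidAlgebra.of_injective.comp Multiplicative.ofAdd.injective

theorem mono_zero : (mono 0 : Laurent K n) = 1 := by
  rw [mono, ofAdd_zero, map_one]

/-- A Laurent polynomial vanishing at every point of a group `G` of points of the split torus
also vanishes on the quotient torus dual to any `π : ℤⁿ → ℤᵐ` killing the monomials that are
trivial on `G`, since distinct characters of `G` are linearly independent. -/
theorem laurentMap_eq_zero_of_forall_eval_eq_zero {G : Type*} [Monoid G]
    (ev : G → (Laurent K n →ₐ[K] K)) (ch : (Fin n → ℤ) → (G →* K))
    (hch : ∀ x g, ch x g = ev g (mono x)) {m : ℕ} (π : (Fin n → ℤ) →+ (Fin m → ℤ))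
    (hπ : ∀ x, (∀ g, ev g (mono x) = 1) → π x = 0) (r : Laurent K n) (hr : ∀ g, ev g r = 0) :
    laurentMap K π r = 0 := by
  have hfac : Function.FactorsThrough (fun x ↦ AddMonoidHom.toMultiplicative π x)
      (fun x : Multiplicative (Fin n → ℤ) ↦ ch x.toAdd) := by
    intro x y hxy
    have h1 : π (x.toAdd - y.toAdd) = 0 := by
      refine hπ _ fun g ↦ ?_
      have h2 : ev g (mono (x.toAdd - y.toAdd)) * ev g (mono y.toAdd) = ev g (mono y.toAdd) := by
        rw [← map_mul, ← map_mul, ← ofAdd_add, sub_add_cancel, ← hch, ← hch]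
        exact DFunLike.congr_fun hxy g
      exact (mul_eq_right₀ (eval_mono_ne_zero _ _)).1 h2
    rw [map_sub, sub_eq_zero] at h1
    exact congrArg Multiplicative.ofAdd h1
  -- The map `π` factors through the characters of `G` defined by monomials, so it suffices that `r`
  -- vanishes when its terms are grouped by character.
  obtain ⟨θ, hθ⟩ := (Function.factorsThrough_iff _).1 hfac
  have h0 : r.coeff.mapDomain (fun x ↦ ch x.toAdd) = 0 := by
    refine linearIndependent_iff.1 (linearIndependent_monoidHom G K) _ ?_
    ext g
    rw [Finsupp.linearCombination_mapDomain]
    have h1 := hr g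
    rw [MonoidAlgebra.lift_unique (ev g) r] at h1
    rw [Finsupp.linearCombination_apply, Finsupp.sum, Finset.sum_apply, Pi.zero_apply, ← h1]
    exact Finset.sum_congr rfl fun x _ ↦ congrArg (r.coeff x • ·) (hch x.toAdd g)
  apply MonoidAlgebra.coeff_injective
  change r.coeff.mapDomain (fun x ↦ AddMonoidHom.toMultiplicative π x) = 0
  rw [hθ, Finsupp.mapDomain_comp, h0, Finsupp.mapDomain_zero]

/-- The coordinate projections of `ℤᵐ` give a chain of `m + 1` quotient tori, hence of `m + 1`
prime ideals, since group algebras of torsion-free abelian groups are domains. -/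
theorem exists_prime_chain {m : ℕ} (π : (Fin n → ℤ) →+ (Fin m → ℤ))
    (hπ : Function.Surjective π) :
    ∃ P : Fin (m + 1) → PrimeSpectrum (Laurent K n), StrictMono P ∧
      ∀ k, RingHom.ker (laurentMap K π) ≤ (P k).asIdeal := by
  -- The `k`-th prime is the kernel of the map forgetting the first `k` coordinates of `ℤᵐ`: setting
  -- these variables to one.
  let tail (k : ℕ) : (Fin m → ℤ) →+ (Fin m → ℤ) :=
    AddMonoidHom.pi fun i ↦ if k ≤ i then Pi.evalAddMonoidHom _ i else 0
  have htail : ∀ k x i, tail k x i = if k ≤ (i : ℕ) then x i else 0 := by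
    intro k x i
    simp only [tail, AddMonoidHom.pi_apply]
    split_ifs <;> rfl
  have hcomp : ∀ k l, k ≤ l → (tail l).comp (tail k) = tail l := by
    intro k l hkl
    refine AddMonoidHom.ext fun x ↦ funext fun i ↦ ?_
    simp only [AddMonoidHom.comp_apply, htail]
    split_ifs <;> first | rfl | omega
  let Φ (k : ℕ) : Laurent K n →+* Laurent K m := laurentMap K ((tail k).comp π)
  have hΦ : ∀ k x, Φ k (mono x) = mono (tail k (π x)) := fun k x ↦ laurentMap_mono _ x
  have hle : ∀ k l, k ≤ l → RingHom.ker (Φ k) ≤ RingHom.ker (Φ l) := by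
    intro k l hkl r hr
    have : Φ l r = laurentMap K (tail l) (Φ k r) := by
      rw [← laurentMap_comp_apply, ← AddMonoidHom.comp_assoc, hcomp k l hkl]
    rw [RingHom.mem_ker] at hr ⊢
    rw [this, hr, map_zero]
  refine ⟨fun k ↦ ⟨RingHom.ker (Φ k), RingHom.ker_isPrime _⟩, ?_, fun k r hr ↦ ?_⟩
  · refine Fin.strictMono_iff_lt_succ.2 fun k ↦ lt_of_le_of_ne (hle k (k + 1) (Nat.le_succ _)) ?_
    intro heq
    have heq' : RingHom.ker (Φ k) = RingHom.ker (Φ (k + 1)) :=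
      congrArg PrimeSpectrum.asIdeal heq
    obtain ⟨x, hx⟩ := hπ (Pi.single k 1)
    have h1 : mono x - 1 ∈ RingHom.ker (Φ (k + 1)) := by
      have : tail (k + 1) (Pi.single k 1) = 0 := by
        ext i
        rw [htail]
        split_ifs with h
        · rw [Pi.single_eq_of_ne (by rintro rfl; omega)]; rfl
        · rfl
      rw [RingHom.mem_ker, map_sub, hΦ, hx, map_one, sub_eq_zero, this, mono_zero]
    rw [← heq', RingHom.mem_ker, map_sub, hΦ, hx, map_one, sub_eq_zero] at h1
    have h2 : tail k (Pi.single k 1) = 0 := mono_injective (h1.trans mono_zero.symm)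
    have h3 := congrFun h2 k
    rw [htail] at h3
    simp at h3
  · change Φ k r = 0
    rw [RingHom.mem_ker] at hr
    rw [laurentMap_comp_apply, hr, map_zero]

end

/-- Dividing `ℤⁿ` by the vectors orthogonal to a set `S ⊆ ℝⁿ` gives a free group of rank at least
the dimension of the span of `S`. The rank may be larger, since `S` need not be rational. -/
theorem exists_quotient_by_orthogonal {n : ℕ} (S : Set (Fin n → ℝ)) :
    ∃ (m : ℕ) (π : (Fin n → ℤ) →+ (Fin m → ℤ)), Function.Surjective π ∧
      (∀ x, (∀ v ∈ S, ∑ i, (x i : ℝ) * v i = 0) → π x = 0) ∧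
      Module.finrank ℝ (Submodule.span ℝ S) ≤ m := by
  let φ : (Fin n → ℤ) →ₗ[ℤ] (S → ℝ) :=
    { toFun := fun x v ↦ ∑ i, (x i : ℝ) * v.1 i
      map_add' := fun x y ↦ by ext v; simp [add_mul, Finset.sum_add_distrib]
      map_smul' := fun c x ↦ by ext v; simp [mul_assoc, Finset.mul_sum] }
  let b := Module.finBasis ℤ (LinearMap.range φ)
  let π : (Fin n → ℤ) →ₗ[ℤ] _ := b.equivFun.toLinearMap ∘ₗ φ.rangeRestrict
  have hπ : Function.Surjective π := b.equivFun.surjective.comp φ.surjective_rangeRestrict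
  refine ⟨_, π.toAddMonoidHom, hπ, fun x hx ↦ ?_, ?_⟩
  · have : φ.rangeRestrict x = 0 := Subtype.ext (funext fun v ↦ hx v.1 v.2)
    change b.equivFun (φ.rangeRestrict x) = 0
    rw [this, map_zero]
  · -- A vector in the span of `S` is determined by its products with lifts of a basis of `ℤᵐ`.
    choose l hl using fun j ↦ hπ (Pi.single j 1)
    let ev (x : Fin n → ℤ) : (Fin n → ℝ) →ₗ[ℝ] ℝ := ∑ i, (x i : ℝ) • LinearMap.proj i
    have hev : ∀ x v, ev x v = ∑ i, (x i : ℝ) * v i := fun x v ↦ by simp [ev]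
    let ψ : Submodule.span ℝ S →ₗ[ℝ] (Fin (Module.finrank ℤ (LinearMap.range φ)) → ℝ) :=
      LinearMap.pi fun j ↦ (ev (l j)).domRestrict _
    have hψ : Function.Injective ψ := by
      rw [injective_iff_map_eq_zero]
      rintro ⟨v, hv⟩ h
      have h1 : ∀ j, ∑ i, (l j i : ℝ) * v i = 0 := fun j ↦ by
        rw [← hev]; exact congrFun h j
      have hker : ∀ x, π x = 0 → ∑ i, (x i : ℝ) * v i = 0 := by
        intro x hx
        have hx' : φ x = 0 := by
          have : φ.rangeRestrict x = 0 := b.equivFun.injective (hx.trans (map_zero _).symm)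
          exact congrArg Subtype.val this
        have : Submodule.span ℝ S ≤ LinearMap.ker (ev x) := Submodule.span_le.2 fun w hw ↦ by
          rw [SetLike.mem_coe, LinearMap.mem_ker, hev]
          exact congrFun hx' ⟨w, hw⟩
        rw [← hev]; exact this hv
      have hall : ∀ x : Fin n → ℤ, ∑ i, (x i : ℝ) * v i = 0 := by
        intro x
        have := hker (x - ∑ j, π x j • l j) (by
          rw [map_sub, map_sum, sub_eq_zero]
          simp_rw [map_smul, hl]
          exact pi_eq_sum_univ' (π x))
        rw [← hev] at this ⊢
        have e : ev (x - ∑ j, π x j • l j) = ev x - ∑ j, (π x j : ℝ) • ev (l j) := by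
          ext w
          simp only [hev, LinearMap.sub_apply, LinearMap.sum_apply, LinearMap.smul_apply,
            LinearMap.comp_apply, Pi.sub_apply, Finset.sum_apply, Pi.smul_apply, smul_eq_mul,
            Int.cast_sub, Int.cast_sum, Int.cast_mul, sub_mul, Finset.sum_sub_distrib,
            Finset.sum_mul, Finset.mul_sum]
          rw [Finset.sum_comm]
          simp only [mul_assoc]
        rw [e] at this
        simpa [hev, h1] using this
      ext i
      simpa [Pi.single_apply] using hall (Pi.single i 1)
    simpa using LinearMap.finrank_le_finrank_of_injective hψ

/-! ### Dimension and integral morphisms -/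

/-- There are no specializations between distinct points of a fibre of an integral morphism. -/
theorem ne_of_lt_of_isIntegralHom {R : CommRingCat.{0}} {X : Scheme.{0}} (g : Spec R ⟶ X)
    [IsIntegralHom g] {P Q : PrimeSpectrum R} (hPQ : P < Q) : g P ≠ g Q := by
  intro heq
  obtain ⟨U, hU, hQU, -⟩ := exists_isAffineOpen_mem_and_subset (x := g Q) (U := ⊤) trivial
  have hV : IsAffineOpen (g ⁻¹ᵁ U) := hU.preimage g
  have hint : (g.appLE U (g ⁻¹ᵁ U) le_rfl).hom.IsIntegral := by
    rw [← Scheme.Hom.app_eq_appLE]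
    exact IsIntegralHom.isIntegral_app g U hU
  have hQV : Q ∈ g ⁻¹ᵁ U := hQU
  have hPV : P ∈ g ⁻¹ᵁ U := by change g P ∈ U; rwa [heq]
  obtain ⟨p, rfl⟩ : P ∈ Set.range hV.fromSpec := by rw [hV.range_fromSpec]; exact hPV
  obtain ⟨q, rfl⟩ : Q ∈ Set.range hV.fromSpec := by rw [hV.range_fromSpec]; exact hQV
  have hpq : p ⤳ q := by
    rw [← hV.fromSpec.isOpenEmbedding.isInducing.specializes_iff]
    exact (PrimeSpectrum.le_iff_specializes _ _).1 hPQ.le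
  have hlt : @LT.lt (PrimeSpectrum Γ(Spec R, g ⁻¹ᵁ U)) _ p q :=
    lt_of_le_of_ne ((PrimeSpectrum.le_iff_specializes p q).2 hpq) fun h ↦ hPQ.ne (congrArg _ h)
  have h1 : Spec.map (g.appLE U (g ⁻¹ᵁ U) le_rfl) p = Spec.map (g.appLE U (g ⁻¹ᵁ U) le_rfl) q := by
    apply hU.fromSpec.isOpenEmbedding.injective
    rw [← Scheme.Hom.comp_apply, ← Scheme.Hom.comp_apply, hU.SpecMap_appLE_fromSpec g hV]
    exact heq
  algebraize [(g.appLE U (g ⁻¹ᵁ U) le_rfl).hom]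
  have : p.asIdeal.IsPrime := p.isPrime
  exact (Ideal.IsIntegral.comap_lt_comap (R := Γ(X, U)) (I := p.asIdeal) (J := q.asIdeal) hlt).ne
    (congrArg PrimeSpectrum.asIdeal h1)

/-- A chain of primes, mapped by an integral morphism into the image of a closed embedding
`i : H → X`, bounds the dimension of `H` from below. -/
theorem le_topologicalKrullDim_of_chain {R : CommRingCat.{0}} {X H : Scheme.{0}} (g : Spec R ⟶ X)
    [IsIntegralHom g] (i : H ⟶ X) [IsClosedImmersion i] {m : ℕ}
    (P : Fin (m + 1) → PrimeSpectrum R) (hP : StrictMono P) (hi : ∀ k, g (P k) ∈ Set.range i) :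
    (m : WithBot ℕ∞) ≤ topologicalKrullDim H := by
  choose w hw using hi
  have hemb := i.isClosedEmbedding
  -- The closures of points of `H` over the `g (P k)`; larger primes have smaller closures.
  let Z (k : (Fin (m + 1))ᵒᵈ) : TopologicalSpace.IrreducibleCloseds H :=
    ⟨closure {w (OrderDual.ofDual k)}, isIrreducible_singleton.closure, isClosed_closure⟩
  have hZ : StrictMono Z := by
    intro a b hab
    have hlt := hP (OrderDual.ofDual_lt_ofDual.2 hab)
    have hs : w (OrderDual.ofDual b) ⤳ w (OrderDual.ofDual a) := by
      rw [← hemb.isInducing.specializes_iff, hw, hw]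
      exact ((PrimeSpectrum.le_iff_specializes _ _).1 hlt.le).map g.continuous
    refine lt_of_le_of_ne (hs.closure_subset) fun h ↦ ?_
    have h2 : w (OrderDual.ofDual b) = w (OrderDual.ofDual a) := by
      have : closure {w (OrderDual.ofDual a)} = closure {w (OrderDual.ofDual b)} :=
        congrArg (fun Z ↦ Z.carrier) h
      exact (inseparable_iff_closure_eq.2 this).eq.symm
    exact ne_of_lt_of_isIntegralHom g hlt (by rw [← hw, ← hw, h2])
  have := Order.krullDim_le_of_strictMono Z hZ
  rw [Order.krullDim_orderDual] at this
  refine le_trans ?_ this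
  exact Order.le_krullDim_iff.2 ⟨LTSeries.mk m id strictMono_id, rfl⟩

/-! ### Integral sections with a given generic point -/

theorem finite_compl_of_nonempty_opens_specInt (W : (Spec (.of ℤ)).Opens)
    (hW : (W : Set (Spec (.of ℤ))).Nonempty) :
    ((W : Set (Spec (.of ℤ)))ᶜ).Finite := by
  obtain ⟨I, hI⟩ :=
    (PrimeSpectrum.isClosed_iff_zeroLocus_ideal (R := ℤ) _).1 W.isOpen.isClosed_compl
  have hI0 : I ≠ ⊥ := by
    rintro rfl
    obtain ⟨x, hx⟩ := hW
    have : x ∈ (W : Set (Spec (.of ℤ)))ᶜ := by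
      rw [hI]
      exact (Set.ext_iff.1 PrimeSpectrum.zeroLocus_bot x).2 trivial
    exact this hx
  obtain ⟨m, hm, hm0⟩ := Submodule.exists_mem_ne_zero_of_ne_bot hI0
  rw [hI]
  refine Set.Finite.of_finite_image
    (f := fun P : PrimeSpectrum ℤ ↦ (Submodule.IsPrincipal.generator P.asIdeal).natAbs)
    (m.natAbs.divisors.finite_toSet.subset ?_) ?_
  · rintro _ ⟨P, hP, rfl⟩
    have h1 : Submodule.IsPrincipal.generator P.asIdeal ∣ m :=
      (Submodule.IsPrincipal.mem_iff_generator_dvd _).1 (hP hm)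
    simpa [hm0] using Int.natAbs_dvd_natAbs.2 h1
  · intro P _ Q _ h
    refine PrimeSpectrum.ext ?_
    rw [← Ideal.span_singleton_generator P.asIdeal, ← Ideal.span_singleton_generator Q.asIdeal]
    exact Int.span_natAbs _ ▸ Int.span_natAbs (Submodule.IsPrincipal.generator Q.asIdeal) ▸
      congrArg (fun n : ℕ ↦ Ideal.span {(n : ℤ)}) h

theorem genericPoint_mem_of_nonempty (W : (Spec (.of ℤ)).Opens)
    (hW : (W : Set (Spec (.of ℤ))).Nonempty) :
    (⊥ : PrimeSpectrum ℤ) ∈ W := by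
  obtain ⟨x, hx⟩ := hW
  exact ((PrimeSpectrum.le_iff_specializes ⊥ x).1 bot_le).mem_open W.isOpen hx

section

variable {X : Scheme.{0}} (L : Type) [Field L] [CharZero L]

theorem specMap_int_apply (x : Spec (.of L)) :
    Spec.map (CommRingCat.ofHom (algebraMap ℤ L)) x = (⊥ : PrimeSpectrum ℤ) := by
  have hx : x = IsLocalRing.closedPoint L := Subsingleton.elim (α := PrimeSpectrum L) _ _
  refine PrimeSpectrum.ext ?_
  change Ideal.comap (algebraMap ℤ L) x.asIdeal = ⊥
  have hx' : x.asIdeal = ⊥ := by rw [hx]; exact IsLocalRing.maximalIdeal_eq_bot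
  rw [hx', ← RingHom.ker_eq_comap_bot]
  exact (RingHom.injective_iff_ker_eq_bot _).1 (algebraMap ℤ L).injective_int

/-- Two sections over `ℤ` with the same generic point agree where both lie in a common affine open,
although they may differ elsewhere if `X` is not separated. -/
theorem opens_ι_comp_eq_of_generic_eq {s s' : Spec (.of ℤ) ⟶ X}
    (h : Spec.map (CommRingCat.ofHom (algebraMap ℤ L)) ≫ s =
      Spec.map (CommRingCat.ofHom (algebraMap ℤ L)) ≫ s')
    {U : X.Opens} (hU : IsAffineOpen U) {W : (Spec (.of ℤ)).Opens} (hW : W ≤ s ⁻¹ᵁ U)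
    (hW' : W ≤ s' ⁻¹ᵁ U) : W.ι ≫ s = W.ι ≫ s' := by
  by_cases hne : (W : Set (Spec (.of ℤ))).Nonempty
  · have hg := genericPoint_mem_of_nonempty W hne
    let ξ := Spec.map (CommRingCat.ofHom (algebraMap ℤ L))
    have hξ : Set.range ξ ⊆ Set.range W.ι := by
      rintro _ ⟨x, rfl⟩
      rw [specMap_int_apply, Scheme.Opens.range_ι]
      exact hg
    let j := IsOpenImmersion.lift W.ι ξ hξ
    have hj : j ≫ W.ι = ξ := IsOpenImmersion.lift_fac ..
    have hs : Set.range (W.ι ≫ s) ⊆ Set.range U.ι := by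
      rintro _ ⟨x, rfl⟩
      rw [Scheme.Opens.range_ι]
      exact hW x.2
    have hs' : Set.range (W.ι ≫ s') ⊆ Set.range U.ι := by
      rintro _ ⟨x, rfl⟩
      rw [Scheme.Opens.range_ι]
      exact hW' x.2
    have : IsAffine U := hU
    have : IsDominant j := by
      constructor
      have : Set.range j = W.ι ⁻¹' Set.range ξ := by
        ext w
        constructor
        · rintro ⟨x, rfl⟩
          exact ⟨x, by rw [← hj, Scheme.Hom.comp_apply]⟩
        · rintro ⟨x, hx⟩
          refine ⟨x, W.ι.isOpenEmbedding.injective ?_⟩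
          rw [← Scheme.Hom.comp_apply, hj, hx]
      rw [DenseRange, this]
      refine Dense.preimage ?_ W.ι.isOpenEmbedding.isOpenMap
      refine (dense_iff_inter_open.2 fun V hV hVne ↦ ?_)
      exact ⟨(⊥ : PrimeSpectrum ℤ), genericPoint_mem_of_nonempty ⟨V, hV⟩ hVne,
        IsLocalRing.closedPoint L, specMap_int_apply L _⟩
    have : IsOpenImmersion.lift U.ι _ hs = IsOpenImmersion.lift U.ι _ hs' := by
      refine ext_of_isDominant j ?_
      rw [← cancel_mono U.ι, Category.assoc, Category.assoc, IsOpenImmersion.lift_fac,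
        IsOpenImmersion.lift_fac, ← Category.assoc, ← Category.assoc, hj]
      exact h
    rw [← IsOpenImmersion.lift_fac U.ι _ hs, this, IsOpenImmersion.lift_fac]
  · have : IsEmpty W := ⟨fun x ↦ hne ⟨x.1, x.2⟩⟩
    exact isInitialOfIsEmpty.hom_ext _ _

/-- The sections over `ℤ` of a quasi-compact scheme with a given generic point are finite in number.
Relative to a finite affine cover, any two of them agree as maps of sets outside a fixed finite set
of primes, and a section is determined by its inverse images of the members of the cover. -/
theorem finite_sections_over_point [CompactSpace X] (t : Spec (.of L) ⟶ X) :
    {s : Spec (.of ℤ) ⟶ X | Spec.map (CommRingCat.ofHom (algebraMap ℤ L)) ≫ s = t}.Finite := by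
  set S := {s : Spec (.of ℤ) ⟶ X | Spec.map (CommRingCat.ofHom (algebraMap ℤ L)) ≫ s = t}
  obtain hS | ⟨s₀, hs₀⟩ := S.eq_empty_or_nonempty
  · rw [hS]; exact Set.finite_empty
  obtain ⟨I, hI, hcov⟩ := isCompact_iff_finite_and_eq_biUnion_affineOpens.1
    (show IsCompact ((⊤ : X.Opens) : Set X) from isCompact_univ)
  have hmem : ∀ x : X, ∃ U ∈ I, x ∈ U.1 := by
    intro x
    have : x ∈ (⊤ : X.Opens) := trivial
    rw [hcov] at this
    simpa using this
  have hgen : ∀ s ∈ S, s (⊥ : PrimeSpectrum ℤ) = s₀ (⊥ : PrimeSpectrum ℤ) := by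
    intro s hs
    let x : Spec (.of L) := IsLocalRing.closedPoint L
    rw [← specMap_int_apply L x, ← Scheme.Hom.comp_apply, ← Scheme.Hom.comp_apply]
    exact congrArg (fun f : Spec (.of L) ⟶ X ↦ f _) (hs.trans hs₀.symm)
  let J := {U ∈ I | s₀ (⊥ : PrimeSpectrum ℤ) ∈ U.1}
  have hJ : J.Finite := hI.subset fun U hU ↦ hU.1
  -- All sections with the given generic point agree with `s₀` on the cofinite set `N`.
  let N : Set (Spec (.of ℤ)) := ⋂ U ∈ J, ((s₀ ⁻¹ᵁ U.1 : (Spec (.of ℤ)).Opens) : Set _)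
  have hNc : Nᶜ.Finite := by
    simp only [N, Set.compl_iInter]
    exact hJ.biUnion fun U hU ↦ finite_compl_of_nonempty_opens_specInt _ ⟨_, hU.2⟩
  have heq : ∀ s ∈ S, ∀ p ∈ N, s p = s₀ p := by
    intro s hs p hp
    obtain ⟨U, hUI, hU⟩ := hmem (s p)
    have hUJ : U ∈ J := ⟨hUI, by
      rw [← hgen s hs]
      exact genericPoint_mem_of_nonempty (s ⁻¹ᵁ U.1) ⟨p, hU⟩⟩
    have hpU : p ∈ s₀ ⁻¹ᵁ U.1 := Set.mem_iInter₂.1 hp U hUJ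
    have := opens_ι_comp_eq_of_generic_eq L (hs.trans hs₀.symm) U.2
      (W := s ⁻¹ᵁ U.1 ⊓ s₀ ⁻¹ᵁ U.1) inf_le_left inf_le_right
    exact congrArg (fun f ↦ f ⟨p, hU, hpU⟩) this
  have : Finite I := hI
  refine Set.Finite.of_finite_image
    (f := fun s (U : I) ↦ ((s ⁻¹ᵁ U.1.1 : (Spec (.of ℤ)).Opens) : Set (Spec (.of ℤ))))
    ((Set.Finite.pi' (t := fun U : I ↦
      (fun A ↦ (A ∪ ((s₀ ⁻¹ᵁ U.1.1 : (Spec (.of ℤ)).Opens) : Set (Spec (.of ℤ))) ∩ N)) '' 𝒫 Nᶜ)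
      fun U ↦ hNc.powerset.image _).subset ?_) ?_
  · rintro _ ⟨s, hs, rfl⟩ U
    refine ⟨((s ⁻¹ᵁ U.1.1 : (Spec (.of ℤ)).Opens) : Set (Spec (.of ℤ))) ∩ Nᶜ,
      Set.inter_subset_right, ?_⟩
    ext p
    by_cases hp : p ∈ N
    · simp [hp, heq s hs p hp]
    · simp [hp]
  · intro s hs s' hs' h
    refine Scheme.hom_ext_of_forall _ _ fun p ↦ ?_
    obtain ⟨U, hUI, hU⟩ := hmem (s p)
    refine ⟨s ⁻¹ᵁ U.1, hU, opens_ι_comp_eq_of_generic_eq L (hs.trans hs'.symm) U.2 le_rfl ?_⟩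
    exact fun q hq ↦ (Set.ext_iff.1 (congrFun h ⟨U, hUI⟩) q).1 hq

end

/-! ### Evaluation of Laurent polynomials at sections of a torus -/

/-- The convolution product, which is the group law on `K`-points of the split torus, is given by
multiplication of coordinates. -/
theorem convMul_apply_mono {K : Type} [Field K] {n : ℕ} (f g : WithConv (Laurent K n →ₐ[K] K))
    (x : Fin n → ℤ) : (f * g).ofConv (mono x) = f.ofConv (mono x) * g.ofConv (mono x) := by
  rw [AlgHom.convMul_apply]
  simp [mono]

theorem sectionsBaseChange_left_fst {S S' : Scheme.{0}} (f : S' ⟶ S) (G : Over S) [GrpObj G]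
    (s : Sections G) :
    (sectionsBaseChange f G s).left ≫ Limits.pullback.fst G.hom f = f ≫ s.left := by
  have h : (Functor.LaxMonoidal.ε (Over.pullback f)).left ≫ Limits.pullback.fst (𝟙 S) f = f := by
    rw [Over.ε_pullback_left, IsIso.inv_comp_eq, ← Limits.pullback.condition, Category.comp_id]
  have h2 : ((Over.pullback f).map s).left ≫ Limits.pullback.fst G.hom f =
      Limits.pullback.fst (𝟙 S) f ≫ s.left :=
    Limits.pullback.lift_fst _ _ _
  change ((Functor.LaxMonoidal.ε (Over.pullback f)).left ≫ ((Over.pullback f).map s).left) ≫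
    Limits.pullback.fst G.hom f = f ≫ s.left
  rw [Category.assoc, h2]
  exact (Category.assoc _ _ _).symm.trans (congrArg (· ≫ s.left) h)

/-- A section of a torus `T` split over `K` is evaluated at Laurent polynomials. The evaluation is
multiplicative on monomials since these are group-like, and the `K`-valued point it defines lies
over the given section. -/
theorem exists_eval {k K : Type} [Field k] [Field K] [Algebra k K] (T : Over (Spec (.of k)))
    [GrpObj T] {n : ℕ} (e : (Over.pullback (Spec.map (CommRingCat.ofHom (algebraMap k K)))).obj T ≅
      splitTorus K n) [IsMonHom e.hom] :
    ∃ ev : Sections T → (Laurent K n →ₐ[K] K),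
      (∀ s t x, ev (s * t) (mono x) = ev s (mono x) * ev t (mono x)) ∧
      ∀ s, Spec.map (CommRingCat.ofHom (ev s).toRingHom) ≫ e.inv.left ≫
        Limits.pullback.fst T.hom (Spec.map (CommRingCat.ofHom (algebraMap k K))) =
          Spec.map (CommRingCat.ofHom (algebraMap k K)) ≫ s.left := by
  let u : (Spec (.of K)).asOver (Spec (.of K)) ⟶ 𝟙_ (Over (Spec (.of K))) := toUnit _
  have hu : u.left = 𝟙 _ := by
    have h := Over.w u
    have h2 : (𝟙_ (Over (Spec (.of K)))).hom = 𝟙 _ := rfl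
    rw [h2] at h
    refine (Category.comp_id _).symm.trans (h.trans ?_)
    change Spec.map (CommRingCat.ofHom (algebraMap K K)) = 𝟙 _
    exact Spec.map_id _
  let p (s : Sections T) : (Spec (.of K)).asOver (Spec (.of K)) ⟶ splitTorus K n :=
    u ≫ sectionsBaseChange _ T s ≫ e.hom
  have hp (s t) : p (s * t) = p s * p t := by
    simp only [p]
    rw [map_mul, MonObj.mul_comp, MonObj.comp_mul]
  let M := Spec.mapMulEquiv (R := K) (S := Laurent K n) (T := K)
  refine ⟨fun s ↦ (M.symm (p s)).ofConv, fun s t x ↦ ?_, fun s ↦ ?_⟩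
  · have h : M.symm (p (s * t)) = M.symm (p s) * M.symm (p t) := by
      rw [hp]
      exact map_mul M.symm (p s) (p t)
    exact (congrArg (fun f ↦ f.ofConv (mono x)) h).trans (convMul_apply_mono _ _ _)
  · have h : Spec.map (CommRingCat.ofHom ((M.symm (p s)).ofConv).toRingHom) = (p s).left :=
      congrArg Over.Hom.left (M.apply_symm_apply (p s))
    rw [h]
    have he : e.hom.left ≫ e.inv.left = 𝟙 _ := by
      rw [← Over.comp_left, e.hom_inv_id, Over.id_left]
    have h2 : (p s).left = (sectionsBaseChange _ T s).left ≫ e.hom.left := by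
      simp only [p, Over.comp_left, hu]
      exact Category.id_comp _
    rw [h2]
    refine Eq.trans ?_ (sectionsBaseChange_left_fst _ T s)
    refine (Category.assoc _ _ _).trans (congrArg (_ ≫ ·) ?_)
    exact (Category.assoc _ _ _).symm.trans ((congrArg (· ≫ _) he).trans (Category.id_comp _))

/-! ### Flat base change of global functions -/

/-- The two maps to a pushout of commutative rings jointly generate it. -/
theorem mem_subring_of_isPushout {A B C D : CommRingCat.{0}} {f : A ⟶ B} {g : A ⟶ C}
    {inl : B ⟶ D} {inr : C ⟶ D} (h : IsPushout f g inl inr) {R : Type} [CommRing R]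
    (φ : D →+* R) (M : Subring R)
    (hB : ∀ b, φ (inl b) ∈ M) (hC : ∀ c, φ (inr c) ∈ M) (d : D) : φ d ∈ M := by
  let l : B ⟶ CommRingCat.of M := CommRingCat.ofHom ((φ.comp inl.hom).codRestrict M hB)
  let r : C ⟶ CommRingCat.of M := CommRingCat.ofHom ((φ.comp inr.hom).codRestrict M hC)
  have hlr : f ≫ l = g ≫ r := by
    ext a
    exact congrArg (fun ψ ↦ φ (ψ.hom a)) h.w
  have hid : h.desc l r hlr ≫ CommRingCat.ofHom M.subtype = CommRingCat.ofHom φ := by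
    apply h.hom_ext
    · rw [h.inl_desc_assoc]; rfl
    · rw [h.inr_desc_assoc]; rfl
  have : (h.desc l r hlr d).1 = φ d := congrArg (fun φ ↦ φ.hom d) hid
  rw [← this]
  exact (h.desc l r hlr d).2

/-- The image of a ring is closed under products, so its span is a subalgebra. -/
theorem span_range_eq_top_of_adjoin_eq_top {K B R : Type} [Field K] [CommRing B] [CommRing R]
    [Algebra K R] (ρ : B →+* R) (h : Algebra.adjoin K (Set.range ρ) = ⊤) :
    Submodule.span K (Set.range ρ) = ⊤ := by
  have hcl : (Submonoid.closure (Set.range ρ) : Set R) = Set.range ρ :=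
    congrArg SetLike.coe (Submonoid.closure_eq (MonoidHom.mrange ρ))
  rw [← Algebra.top_toSubmodule, ← h, Algebra.adjoin_eq_span, hcl]

theorem span_range_eq_top_of_isPushout {A B C D : CommRingCat.{0}} {f : A ⟶ B} {g : A ⟶ C}
    {inl : B ⟶ D} {inr : C ⟶ D} (h : IsPushout f g inl inr) {K R : Type} [Field K] [CommRing R]
    [Algebra K R] (eC : C ≅ .of K) (eD : D ≅ .of R)
    (he : inr ≫ eD.hom = eC.hom ≫ CommRingCat.ofHom (algebraMap K R)) :
    Submodule.span K (Set.range (inl ≫ eD.hom).hom) = ⊤ := by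
  set ρ := (inl ≫ eD.hom).hom
  have hadj : Algebra.adjoin K (Set.range ρ) = ⊤ := by
    have h1 := mem_subring_of_isPushout h eD.hom.hom
      (Algebra.adjoin K (Set.range ρ)).toSubring
      (fun b ↦ Algebra.subset_adjoin ⟨b, rfl⟩) fun c ↦ by
        have : eD.hom.hom (inr c) = algebraMap K R (eC.hom c) := congrArg (fun ψ ↦ ψ.hom c) he
        rw [this]
        exact Subalgebra.algebraMap_mem _ _
    refine Algebra.eq_top_iff.2 fun r ↦ ?_
    have h2 := h1 (eD.inv.hom r)
    have h3 : eD.hom.hom (eD.inv.hom r) = r := congrArg (fun ψ ↦ ψ.hom r) eD.inv_hom_id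
    rwa [h3] at h2
  exact span_range_eq_top_of_adjoin_eq_top ρ hadj

/-- Flat base change for global functions: those of `X ×_ℤ Spec K = Spec R` are `K`-linear
combinations of those of `X`. -/
theorem span_range_appTop_eq_top {X : Scheme.{0}} [CompactSpace X] [QuasiSeparatedSpace X]
    (x : X ⟶ Spec (.of ℤ)) {K R : Type} [Field K] [CharZero K] [CommRing R] [Algebra K R]
    {q : Spec (.of R) ⟶ X}
    (H : IsPullback q (Spec.map (CommRingCat.ofHom (algebraMap K R))) x
      (Spec.map (CommRingCat.ofHom (algebraMap ℤ K)))) :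
    Submodule.span K (Set.range (q.appTop ≫ (Scheme.ΓSpecIso (.of R)).hom).hom) = ⊤ := by
  have hflat : Flat (Spec.map (CommRingCat.ofHom (algebraMap ℤ K))) := by
    rw [Flat.SpecMap_iff]
    change (algebraMap ℤ K).Flat
    rw [RingHom.flat_algebraMap_iff]
    infer_instance
  have hiso := isIso_pushoutSection_of_isQuasiSeparated_of_flat_right H (US := ⊤) (UT := ⊤)
    (UX := ⊤) (UY := ⊤) le_rfl le_rfl (by simp) (isAffineOpen_top _) (isAffineOpen_top _)
    isCompact_univ isQuasiSeparated_univ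
  have hpush := (isIso_pushoutSection_iff H (US := ⊤) (UT := ⊤)
    (UX := ⊤) (UY := ⊤) le_rfl le_rfl (by simp)).1 hiso
  have := span_range_eq_top_of_isPushout hpush (Scheme.ΓSpecIso (.of K)) (Scheme.ΓSpecIso (.of R))
  have e₁ : q.appLE ⊤ ⊤ le_rfl = q.appTop := (Scheme.Hom.app_eq_appLE q).symm
  have e₂ : (Spec.map (CommRingCat.ofHom (algebraMap K R))).appLE ⊤ ⊤ le_rfl =
    (Spec.map (CommRingCat.ofHom (algebraMap K R))).appTop := (Scheme.Hom.app_eq_appLE _).symm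
  rw [e₁, e₂] at this
  exact this (Scheme.ΓSpecIso_naturality _)

/-! ### Compactness of the group of integral `p`-adic points -/

/-- For a ring `B`, the set of ring homomorphisms from `B` to `ℤ_p` is compact for the topology of
pointwise convergence, by Tychonoff's theorem; hence so are its continuous images. -/
theorem isCompact_range_of_pointwise_continuous {p : ℕ} [Fact p.Prime] {B : Type} [CommRing B]
    {Z : Type*} [TopologicalSpace Z] (F : (B →+* ℤ_[p]) → Z)
    (hF : @Continuous _ _ (.induced (fun φ (b : B) ↦ φ b) inferInstance) _ F) :
    IsCompact (Set.range F) := by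
  let _ : TopologicalSpace (B →+* ℤ_[p]) := .induced (fun φ (b : B) ↦ φ b) inferInstance
  have hind : Topology.IsInducing (fun (φ : B →+* ℤ_[p]) (b : B) ↦ φ b) := ⟨rfl⟩
  have hrange : Set.range (fun (φ : B →+* ℤ_[p]) (b : B) ↦ φ b) =
      {f | f 1 = 1} ∩
        ({f | ∀ a b, f (a * b) = f a * f b} ∩ {f | ∀ a b, f (a + b) = f a + f b}) := by
    ext f
    constructor
    · rintro ⟨φ, rfl⟩
      exact ⟨map_one φ, map_mul φ, map_add φ⟩
    · rintro ⟨h1, hm, ha⟩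
      exact ⟨RingHom.mk' ⟨⟨f, h1⟩, hm⟩ ha, rfl⟩
  have hclosed : IsClosed (Set.range (fun (φ : B →+* ℤ_[p]) (b : B) ↦ φ b)) := by
    rw [hrange]
    refine (isClosed_eq (by fun_prop) (by fun_prop)).inter (IsClosed.inter ?_ ?_) <;>
    · simp only [Set.ofPred_forall]
      exact isClosed_iInter fun a ↦ isClosed_iInter fun b ↦ isClosed_eq (by fun_prop) (by fun_prop)
  have : CompactSpace (B →+* ℤ_[p]) := by
    rw [← isCompact_univ_iff, hind.isCompact_iff, Set.image_univ]
    exact hclosed.isCompact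
  exact isCompact_range hF

open TensorProduct in
/-- Elements of `B ⊗ ℚ` have a common denominator. -/
theorem exists_int_mul_eq_tmul_one {B : Type} [CommRing B] (r : B ⊗[ℤ] ℚ) :
    ∃ (N : ℤ) (b : B), N ≠ 0 ∧ (N : B ⊗[ℤ] ℚ) * r = b ⊗ₜ 1 := by
  induction r with
  | zero => exact ⟨1, 0, one_ne_zero, by simp⟩
  | tmul b q =>
    refine ⟨q.den, b * q.num, by exact_mod_cast q.den_ne_zero, ?_⟩
    have h : (b * (q.num : B)) = q.num • b := by rw [zsmul_eq_mul, mul_comm]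
    rw [h, TensorProduct.smul_tmul, ← zsmul_eq_mul, TensorProduct.smul_tmul',
      TensorProduct.smul_tmul]
    congr 1
    rw [zsmul_eq_mul, zsmul_eq_mul]
    push_cast
    rw [mul_one, Rat.den_mul_eq_num]
  | add x y hx hy =>
    obtain ⟨N, b, hN, hx⟩ := hx
    obtain ⟨M, c, hM, hy⟩ := hy
    refine ⟨N * M, M * b + N * c, mul_ne_zero hN hM, ?_⟩
    have e1 : (((M : B) * b + N * c) ⊗ₜ (1 : ℚ) : B ⊗[ℤ] ℚ) =
        (M : B ⊗[ℤ] ℚ) * (b ⊗ₜ 1) + (N : B ⊗[ℤ] ℚ) * (c ⊗ₜ 1) := by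
      have : ∀ (z : ℤ) (b : B), (((z : B) * b) ⊗ₜ (1 : ℚ) : B ⊗[ℤ] ℚ) =
          (z : B ⊗[ℤ] ℚ) * (b ⊗ₜ 1) := fun z b ↦ by
        rw [← zsmul_eq_mul, ← zsmul_eq_mul, TensorProduct.smul_tmul']
      rw [TensorProduct.add_tmul, this, this]
    rw [e1, ← hx, ← hy]
    push_cast
    ring

section

variable (𝒯 : Over (Spec (.of ℤ))) (p : ℕ) [Fact p.Prime]

theorem hom_specInt_ext {X : Scheme.{0}} (f g : X ⟶ Spec (.of ℤ)) : f = g :=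
  specZIsTerminal.hom_ext f g

theorem points_genericFiber_ext {Y : Over (Spec (.of ℚ))} {x y : Y ⟶ genericFiber 𝒯}
    (h : x.left ≫ Limits.pullback.fst 𝒯.hom specRatToInt =
      y.left ≫ Limits.pullback.fst 𝒯.hom specRatToInt) : x = y := by
  ext1
  refine Limits.pullback.hom_ext h ?_
  exact (Over.w x).trans (Over.w y).symm

/-- The morphism from `Spec ℚ_p` to the generic fibre of `Spec ℤ_p`. -/
noncomputable def specPadicToGenericFiber :
    Over.mk (Spec.map (CommRingCat.ofHom (algebraMap ℚ ℚ_[p]))) ⟶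
      genericFiber (Over.mk (Spec.map (CommRingCat.ofHom (algebraMap ℤ ℤ_[p])))) :=
  Over.homMk (Limits.pullback.lift (Spec.map (CommRingCat.ofHom (algebraMap ℤ_[p] ℚ_[p])))
    (Spec.map (CommRingCat.ofHom (algebraMap ℚ ℚ_[p]))) (hom_specInt_ext _ _))
    (Limits.pullback.lift_snd _ _ _)

/-- The homomorphism `𝒯(ℤ_p) → T(ℚ_p)`, where `T` is the generic fibre of `𝒯`. -/
noncomputable def integralPoints [GrpObj 𝒯] : Points 𝒯 ℤ_[p] →* Points (genericFiber 𝒯) ℚ_[p] where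
  toFun z := specPadicToGenericFiber p ≫ (Over.pullback specRatToInt).map z
  map_one' := by rw [Functor.map_one, MonObj.comp_one]
  map_mul' x y := by rw [Functor.map_mul, MonObj.comp_mul]

theorem integralPoints_left_fst [GrpObj 𝒯] (z : Points 𝒯 ℤ_[p]) :
    (integralPoints 𝒯 p z).left ≫ Limits.pullback.fst 𝒯.hom specRatToInt =
      Spec.map (CommRingCat.ofHom (algebraMap ℤ_[p] ℚ_[p])) ≫ z.left := by
  have h2 : ((Over.pullback specRatToInt).map z).left ≫ Limits.pullback.fst 𝒯.hom specRatToInt =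
      Limits.pullback.fst _ _ ≫ z.left :=
    Limits.pullback.lift_fst _ _ _
  change ((specPadicToGenericFiber p).left ≫ ((Over.pullback specRatToInt).map z).left) ≫
    Limits.pullback.fst 𝒯.hom specRatToInt = _
  rw [Category.assoc, h2]
  exact (Category.assoc _ _ _).symm.trans
    (congrArg (· ≫ z.left) (Limits.pullback.lift_fst _ _ _))

theorem sectionsToPoints_toGeneric [GrpObj 𝒯] (s : Sections 𝒯) :
    sectionsToPoints (genericFiber 𝒯) ℚ_[p] (toGeneric 𝒯 s) =
      integralPoints 𝒯 p (sectionsToPoints 𝒯 ℤ_[p] s) := by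
  apply points_genericFiber_ext
  rw [integralPoints_left_fst]
  have h1 : (sectionsToPoints (genericFiber 𝒯) ℚ_[p] (toGeneric 𝒯 s)).left =
      Spec.map (CommRingCat.ofHom (algebraMap ℚ ℚ_[p])) ≫ (toGeneric 𝒯 s).left := rfl
  have h2 : (sectionsToPoints 𝒯 ℤ_[p] s).left =
      Spec.map (CommRingCat.ofHom (algebraMap ℤ ℤ_[p])) ≫ s.left := rfl
  rw [h1, h2]
  refine (Category.assoc _ _ _).trans ?_
  rw [sectionsBaseChange_left_fst]
  refine (Category.assoc _ _ _).symm.trans ?_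
  refine Eq.trans ?_ (Category.assoc _ _ _)
  exact congrArg (· ≫ s.left) (hom_specInt_ext _ _)

open TensorProduct

variable {𝒯} {U : 𝒯.left.Opens} (hU : IsAffineOpen U)

/-- The map from the generic fibre `Spec (Γ(U) ⊗ ℚ)` of an affine open subscheme `U` of `𝒯` to the
generic fibre of `𝒯`. -/
noncomputable def genericAffine :
    Spec (.of (Γ(𝒯.left, U) ⊗[ℤ] ℚ)) ⟶ (genericFiber 𝒯).left :=
  Limits.pullback.lift
    (Spec.map (CommRingCat.ofHom Algebra.TensorProduct.includeLeftRingHom) ≫ hU.fromSpec)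
    (Spec.map (CommRingCat.ofHom (Algebra.TensorProduct.includeRight (R := ℤ)
      (A := Γ(𝒯.left, U)) (B := ℚ)).toRingHom)) (hom_specInt_ext _ _)

/-- The homomorphism `B ⊗ ℚ → ℚ_p` extending a homomorphism `B → ℤ_p`. -/
noncomputable def genericHom {B : Type} [CommRing B] (φ : B →+* ℤ_[p]) : B ⊗[ℤ] ℚ →+* ℚ_[p] :=
  (Algebra.TensorProduct.lift (((algebraMap ℤ_[p] ℚ_[p]).comp φ).toIntAlgHom)
    ((algebraMap ℚ ℚ_[p]).toIntAlgHom) (fun _ _ ↦ Commute.all _ _)).toRingHom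

theorem genericHom_tmul_one {B : Type} [CommRing B] (φ : B →+* ℤ_[p]) (b : B) :
    genericHom p φ (b ⊗ₜ 1) = (φ b : ℚ_[p]) := by
  change Algebra.TensorProduct.lift _ _ _ (b ⊗ₜ 1) = _
  rw [Algebra.TensorProduct.lift_tmul, map_one, mul_one]
  rfl

theorem genericHom_one_tmul {B : Type} [CommRing B] (φ : B →+* ℤ_[p]) (q : ℚ) :
    genericHom p φ (1 ⊗ₜ q) = algebraMap ℚ ℚ_[p] q := by
  change Algebra.TensorProduct.lift _ _ (fun _ _ ↦ Commute.all _ _) (1 ⊗ₜ q) = _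
  rw [Algebra.TensorProduct.lift_tmul, map_one, one_mul]
  rfl

/-- The `ℤ_p`-valued point of `𝒯` given by a `ℤ_p`-valued point of the affine open `U`. -/
noncomputable def affinePoint (φ : Γ(𝒯.left, U) →+* ℤ_[p]) : Points 𝒯 ℤ_[p] :=
  Over.homMk (Spec.map (CommRingCat.ofHom φ) ≫ hU.fromSpec) (hom_specInt_ext _ _)

theorem integralPoints_affinePoint_left [GrpObj 𝒯] (φ : Γ(𝒯.left, U) →+* ℤ_[p]) :
    (integralPoints 𝒯 p (affinePoint p hU φ)).left =
      Spec.map (CommRingCat.ofHom (genericHom p φ)) ≫ genericAffine hU := by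
  refine Limits.pullback.hom_ext ?_ ?_
  · rw [integralPoints_left_fst, Category.assoc, genericAffine, Limits.pullback.lift_fst]
    change Spec.map _ ≫ Spec.map _ ≫ hU.fromSpec = _
    rw [← Spec.map_comp_assoc, ← Spec.map_comp_assoc]
    congr 2
    ext b
    exact (genericHom_tmul_one p φ b).symm
  · refine (Over.w (integralPoints 𝒯 p (affinePoint p hU φ))).trans ?_
    rw [Category.assoc, genericAffine, Limits.pullback.lift_snd, ← Spec.map_comp]
    change Spec.map (CommRingCat.ofHom (algebraMap ℚ ℚ_[p])) = _
    congr 1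
    ext q
    exact (genericHom_one_tmul p φ q).symm

/-- The points of `T(ℚ_p)` coming from `U(ℤ_p)`, for an affine open `U` of `𝒯`, form a compact set.
The `p`-adic topology on `T(ℚ_p)` is defined by affine opens `Spec A` of `T` that are unrelated to
`U`; near a point in both, a function on `Spec A` becomes a quotient of functions on `U`, which is
continuous for pointwise convergence on `U(ℤ_p)`. -/
theorem isCompact_range_integralPoints_affinePoint [GrpObj 𝒯] :
    IsCompact (Set.range fun φ ↦ integralPoints 𝒯 p (affinePoint p hU φ)) := by
  refine isCompact_range_of_pointwise_continuous _ ?_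
  let _ : TopologicalSpace (Γ(𝒯.left, U) →+* ℤ_[p]) :=
    .induced (fun φ (b : Γ(𝒯.left, U)) ↦ φ b) inferInstance
  have hev : ∀ b : Γ(𝒯.left, U), Continuous fun φ : Γ(𝒯.left, U) →+* ℤ_[p] ↦ (φ b : ℚ_[p]) :=
    fun b ↦ continuous_subtype_val.comp ((continuous_apply b).comp continuous_induced_dom)
  refine continuous_generateFrom_iff.2 ?_
  rintro _ ⟨A, j, hj, f, V, hV, rfl⟩
  refine isOpen_iff_mem_nhds.2 fun φ₀ hφ₀ ↦ ?_
  obtain ⟨α₀, hα₀, hfV⟩ := hφ₀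
  let B := Γ(𝒯.left, U)
  rw [integralPoints_affinePoint_left] at hα₀
  let ξ := genericAffine hU
  let x : Spec (.of ℚ_[p]) := IsLocalRing.closedPoint ℚ_[p]
  -- Near the given point, the affine open `Spec A` contains the image of a basic open set `b ≠ 0`
  -- of `Spec (Γ(U) ⊗ ℚ)`, where `b` may be taken in `Γ(U)` by clearing denominators.
  let O : (Spec (.of (B ⊗[ℤ] ℚ))).Opens := ξ ⁻¹ᵁ j.opensRange
  have hyO : Spec.map (CommRingCat.ofHom (genericHom p φ₀)) x ∈ O := by
    change ξ _ ∈ j.opensRange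
    rw [← Scheme.Hom.comp_apply, hα₀, Scheme.Hom.comp_apply]
    exact ⟨_, rfl⟩
  obtain ⟨_, ⟨h, rfl⟩, hyh, hhO⟩ :=
    PrimeSpectrum.isTopologicalBasis_basic_opens.exists_subset_of_mem_open hyO O.isOpen
  obtain ⟨M, b, hM, hMb⟩ := exists_int_mul_eq_tmul_one h
  have hb₀ : (φ₀ b : ℚ_[p]) ≠ 0 := by
    rw [← genericHom_tmul_one, ← hMb, map_mul, map_intCast]
    refine mul_ne_zero (Int.cast_ne_zero.2 hM) fun h0 ↦ hyh ?_
    change genericHom p φ₀ h ∈ x.asIdeal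
    rw [h0]
    exact zero_mem _
  let Rb := Localization.Away (b ⊗ₜ[ℤ] (1 : ℚ))
  have hrange : Set.range (Spec.map (CommRingCat.ofHom (algebraMap (B ⊗[ℤ] ℚ) Rb)) ≫ ξ) ⊆
      Set.range j := by
    rintro _ ⟨y, rfl⟩
    rw [Scheme.Hom.comp_apply]
    refine hhO fun (hmem : h ∈ (Spec.map (CommRingCat.ofHom (algebraMap _ Rb)) y).asIdeal) ↦ ?_
    have hb : algebraMap (B ⊗[ℤ] ℚ) Rb (b ⊗ₜ 1) ∈ y.asIdeal :=
      (congrArg (· ∈ y.asIdeal.comap (algebraMap (B ⊗[ℤ] ℚ) Rb)) hMb).mp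
        (Ideal.mul_mem_left _ (M : B ⊗[ℤ] ℚ) hmem)
    exact y.isPrime.ne_top (Ideal.eq_top_of_isUnit_mem _ hb
      (IsLocalization.Away.algebraMap_isUnit (b ⊗ₜ[ℤ] (1 : ℚ))))
  let θ : A ⟶ .of Rb := Spec.preimage (IsOpenImmersion.lift j _ hrange)
  have hθ : Spec.map θ ≫ j = Spec.map (CommRingCat.ofHom (algebraMap (B ⊗[ℤ] ℚ) Rb)) ≫ ξ := by
    rw [Spec.map_preimage, IsOpenImmersion.lift_fac]
  -- On this basic open set, `f` is the quotient `c / (N * b ^ k)` for some `c` in `Γ(U)`.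
  obtain ⟨k, r, hr⟩ := IsLocalization.Away.surj (b ⊗ₜ[ℤ] (1 : ℚ)) (θ f)
  obtain ⟨N, c, hN, hNc⟩ := exists_int_mul_eq_tmul_one r
  have key : ∀ φ : B →+* ℤ_[p], (φ b : ℚ_[p]) ≠ 0 → ∃ α : A ⟶ .of ℚ_[p],
      (integralPoints 𝒯 p (affinePoint p hU φ)).left = Spec.map α ≫ j ∧
      α f = (φ c : ℚ_[p]) / (N * (φ b : ℚ_[p]) ^ k) := by
    intro φ hb
    have hu : IsUnit (genericHom p φ (b ⊗ₜ 1)) := by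
      rw [genericHom_tmul_one]; exact hb.isUnit
    let ψ : Rb →+* ℚ_[p] := IsLocalization.Away.lift (b ⊗ₜ[ℤ] (1 : ℚ)) hu
    have hψ : ψ.comp (algebraMap _ _) = genericHom p φ := IsLocalization.Away.lift_comp _ hu
    refine ⟨θ ≫ CommRingCat.ofHom ψ, ?_, ?_⟩
    · rw [integralPoints_affinePoint_left, Spec.map_comp, Category.assoc, hθ,
        ← Spec.map_comp_assoc, ← CommRingCat.ofHom_comp, hψ]
    · change ψ (θ f) = _
      have h1 := congrArg ψ hr
      have h2 := congrArg (genericHom p φ) hNc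
      have h3 : ψ (algebraMap (B ⊗[ℤ] ℚ) Rb (b ⊗ₜ 1)) = (φ b : ℚ_[p]) :=
        (RingHom.congr_fun hψ (b ⊗ₜ 1)).trans (genericHom_tmul_one p φ b)
      have h4 : ψ (algebraMap (B ⊗[ℤ] ℚ) Rb r) = genericHom p φ r := RingHom.congr_fun hψ r
      rw [map_mul, map_pow] at h1
      replace h1 : ψ (θ f) * (φ b : ℚ_[p]) ^ k = genericHom p φ r :=
        (congrArg (fun t ↦ ψ (θ f) * t ^ k) h3).symm.trans (h1.trans h4)
      rw [map_mul, genericHom_tmul_one, map_intCast] at h2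
      have hN' : (N : ℚ_[p]) ≠ 0 := Int.cast_ne_zero.2 hN
      rw [eq_div_iff (mul_ne_zero hN' (pow_ne_zero _ hb)), ← h2, ← h1]
      ring
  have hcont : ContinuousAt (fun φ : B →+* ℤ_[p] ↦
      (φ c : ℚ_[p]) / (N * (φ b : ℚ_[p]) ^ k)) φ₀ :=
    (hev c).continuousAt.div (continuous_const.mul ((hev b).pow k)).continuousAt
      (mul_ne_zero (Int.cast_ne_zero.2 hN) (pow_ne_zero _ hb₀))
  have hV₀ : (φ₀ c : ℚ_[p]) / (N * (φ₀ b : ℚ_[p]) ^ k) ∈ V := by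
    obtain ⟨α, hα, hαf⟩ := key φ₀ hb₀
    rw [integralPoints_affinePoint_left, hα₀] at hα
    rw [← hαf, ← Spec.map_injective ((cancel_mono j).1 hα)]
    exact hfV
  filter_upwards [hcont.preimage_mem_nhds (hV.mem_nhds hV₀),
    (isOpen_compl_singleton.preimage (hev b)).mem_nhds hb₀] with φ hφV hφb
  obtain ⟨α, hα, hαf⟩ := key φ hφb
  exact ⟨α, hα, (congrArg (· ∈ V) hαf).mpr hφV⟩

/-- A `ℤ_p`-valued point factors through any open subscheme containing the image of the closed
point, so a finite affine cover of `𝒯` gives a finite cover of `𝒯(ℤ_p)`. -/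
theorem isCompact_range_integralPoints [GrpObj 𝒯] [CompactSpace 𝒯.left] :
    IsCompact (Set.range (integralPoints 𝒯 p)) := by
  obtain ⟨I, hI, hcov⟩ := isCompact_iff_finite_and_eq_biUnion_affineOpens.1
    (show IsCompact ((⊤ : 𝒯.left.Opens) : Set 𝒯.left) from isCompact_univ)
  have : Set.range (integralPoints 𝒯 p) =
      ⋃ U ∈ I, Set.range fun φ ↦ integralPoints 𝒯 p (affinePoint p U.2 φ) := by
    refine subset_antisymm ?_ (Set.iUnion₂_subset fun U _ ↦ ?_)
    · rintro _ ⟨z, rfl⟩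
      let x : Spec (.of ℤ_[p]) := IsLocalRing.closedPoint ℤ_[p]
      obtain ⟨U, hUI, hU⟩ : ∃ U ∈ I, z.left x ∈ U.1 := by
        have : z.left x ∈ (⊤ : 𝒯.left.Opens) := trivial
        rw [hcov] at this
        simpa using this
      have : IsOpenImmersion U.2.fromSpec := IsAffineOpen.isOpenImmersion_fromSpec U.2
      have hr : Set.range z.left ⊆ Set.range U.2.fromSpec := by
        rintro _ ⟨y, rfl⟩
        rw [U.2.range_fromSpec]
        exact ((IsLocalRing.specializes_closedPoint y).map z.left.continuous).mem_open U.1.isOpen hU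
      refine Set.mem_iUnion₂.2 ⟨U, hUI,
        (Spec.preimage (IsOpenImmersion.lift U.2.fromSpec z.left hr)).hom, ?_⟩
      refine congrArg (integralPoints 𝒯 p) ?_
      ext1
      change Spec.map (Spec.preimage _) ≫ U.2.fromSpec = z.left
      rw [Spec.map_preimage, IsOpenImmersion.lift_fac]
    · rintro _ ⟨φ, rfl⟩
      exact ⟨_, rfl⟩
  rw [this]
  exact hI.isCompact_biUnion fun U _ ↦ isCompact_range_integralPoints_affinePoint p U.2

/-- The points of `T(ℚ)` coming from `𝒯(ℤ)` lie in the compact subgroup of `T(ℚ_p)` of points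
coming from `𝒯(ℤ_p)`. -/
theorem toGeneric_mem_finitePart [GrpObj 𝒯] [CompactSpace 𝒯.left] (s : Sections 𝒯) :
    toGeneric 𝒯 s ∈ finitePart (genericFiber 𝒯) p :=
  ⟨(integralPoints 𝒯 p).range, isCompact_range_integralPoints p,
    sectionsToPoints 𝒯 ℤ_[p] s, (sectionsToPoints_toGeneric 𝒯 p s).symm⟩

end

/-! ### The logarithmic map on the sections of a torus -/

section

variable {k K : Type} [Field k] [Field K] [Algebra k K] {T : Over (Spec (.of k))} [GrpObj T] {n : ℕ}

/-- The character of the group of sections of a torus given by the monomial with exponent vector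
`x`. -/
noncomputable def evalCharacter (ev : Sections T → (Laurent K n →ₐ[K] K))
    (hmul : ∀ s t x, ev (s * t) (mono x) = ev s (mono x) * ev t (mono x)) (x : Fin n → ℤ) :
    Sections T →* K where
  toFun s := ev s (mono x)
  map_one' := by
    have h := hmul 1 1 x
    rw [mul_one] at h
    exact (mul_eq_left₀ (eval_mono_ne_zero _ x)).1 h.symm
  map_mul' s t := hmul s t x

/-- The logarithmic coordinates of the sections of a torus, as a homomorphism. -/
noncomputable def logMap (ev : Sections T → (Laurent K n →ₐ[K] K))
    (hmul : ∀ s t x, ev (s * t) (mono x) = ev s (mono x) * ev t (mono x)) (σ : K →+* ℂ) :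
    Sections T →* Multiplicative (Fin n → ℝ) :=
  MonoidHom.mk' (fun s ↦ Multiplicative.ofAdd (logCoord σ (ev s))) fun s t ↦ by
    rw [← ofAdd_add]
    congr 1
    ext i
    have h (s) : ‖σ (ev s (mono (Pi.single i 1)))‖ ≠ 0 :=
      norm_ne_zero_iff.2 ((map_ne_zero σ).2 (eval_mono_ne_zero _ _))
    simp only [logCoord, Pi.add_apply]
    rw [hmul, map_mul, norm_mul, Real.log_mul (h s) (h t)]

/-- A closed subscheme `H` of a torus has dimension at least that of the span of the logarithmic
coordinates of any group `Γ` of rational points of `T` contained in it: geometrically, `H` contains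
the subtorus cut out by the characters that have absolute value one on `Γ`. -/
theorem finrank_span_logCoord_le [Algebra.IsAlgebraic k K]
    {e : (Over.pullback (Spec.map (CommRingCat.ofHom (algebraMap k K)))).obj T ≅ splitTorus K n}
    {ev : Sections T → (Laurent K n →ₐ[K] K)}
    (hmul : ∀ s t x, ev (s * t) (mono x) = ev s (mono x) * ev t (mono x))
    (hev : ∀ s, Spec.map (CommRingCat.ofHom (ev s).toRingHom) ≫ e.inv.left ≫
      Limits.pullback.fst T.hom (Spec.map (CommRingCat.ofHom (algebraMap k K))) =
        Spec.map (CommRingCat.ofHom (algebraMap k K)) ≫ s.left)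
    (σ : K →+* ℂ) {H : Over (Spec (.of k))} (i : H ⟶ T) [IsClosedImmersion i.left]
    (Γ : Subgroup (Sections T)) (hΓ : ∀ s ∈ Γ, ∃ t : Sections H, t ≫ i = s) :
    (Module.finrank ℝ (Submodule.span ℝ ((fun s ↦ logCoord σ (ev s)) '' (Γ : Set (Sections T)))) :
      WithBot ℕ∞) ≤ topologicalKrullDim H.left := by
  obtain ⟨m, π, hπs, hπ, hm⟩ :=
    exists_quotient_by_orthogonal ((fun s ↦ logCoord σ (ev s)) '' (Γ : Set (Sections T)))
  obtain ⟨P, hP, hker⟩ := exists_prime_chain (K := K) π hπs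
  let g : Spec (.of (Laurent K n)) ⟶ T.left := e.inv.left ≫
    Limits.pullback.fst T.hom (Spec.map (CommRingCat.ofHom (algebraMap k K)))
  have hint : IsIntegralHom (Spec.map (CommRingCat.ofHom (algebraMap k K))) := by
    rw [IsIntegralHom.SpecMap_iff]
    exact (algebraMap_isIntegral_iff (R := k) (A := K)).2 inferInstance
  have hg : IsIntegralHom g := by
    have : IsIso e.inv.left := inferInstanceAs (IsIso ((Over.forget _).map e.inv))
    have h1 : IsIntegralHom e.inv.left := inferInstance
    have h2 : IsIntegralHom
        (Limits.pullback.fst T.hom (Spec.map (CommRingCat.ofHom (algebraMap k K)))) :=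
      MorphismProperty.of_isPullback (P := @IsIntegralHom) (IsPullback.of_hasPullback _ _).flip hint
    exact MorphismProperty.comp_mem _ _ _ h1 h2
  refine (Nat.cast_le.2 hm).trans (le_topologicalKrullDim_of_chain g i.left P hP fun j ↦ ?_)
  -- The primes of the chain lie over `H` as soon as they contain the ideal `I` of its preimage, and
  -- elements of `I` vanish at the points of `Γ`.
  have hclosed : IsClosed (g ⁻¹' Set.range i.left) :=
    i.left.isClosedEmbedding.isClosed_range.preimage g.continuous
  obtain ⟨I, hI⟩ := (PrimeSpectrum.isClosed_iff_zeroLocus_ideal (R := Laurent K n) _).1 hclosed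
  suffices P j ∈ PrimeSpectrum.zeroLocus (I : Set (Laurent K n)) by
    rw [← hI] at this
    exact this
  refine fun r hr ↦ hker j (laurentMap_eq_zero_of_forall_eval_eq_zero (fun s : Γ ↦ ev s)
    (fun x ↦ (evalCharacter ev hmul x).comp Γ.subtype) (fun _ _ ↦ rfl) π ?_ r ?_)
  · intro x hx
    refine hπ x ?_
    rintro _ ⟨s, hs, rfl⟩
    rw [← log_norm_eval_mono, hx ⟨s, hs⟩, map_one, norm_one, Real.log_one]
  · rintro ⟨s, hs⟩
    obtain ⟨t, rfl⟩ := hΓ s hs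
    let o : Spec (.of K) := IsLocalRing.closedPoint K
    have ho : Spec.map (CommRingCat.ofHom (ev (t ≫ i)).toRingHom) o ∈
        PrimeSpectrum.zeroLocus (I : Set (Laurent K n)) := by
      rw [← hI]
      refine ⟨(Spec.map (CommRingCat.ofHom (algebraMap k K)) ≫ t.left) o, ?_⟩
      rw [← Scheme.Hom.comp_apply, ← Scheme.Hom.comp_apply, hev]
      rfl
    have h : ev (t ≫ i) r ∈ IsLocalRing.maximalIdeal K := ho hr
    rwa [IsLocalRing.maximalIdeal_eq_bot, Ideal.mem_bot] at h

/-- A section of a torus is determined by its coordinates in `K`, as `Spec K → Spec k` is an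
epimorphism, and products of coordinates commute. -/
theorem mul_comm_of_eval
    {e : (Over.pullback (Spec.map (CommRingCat.ofHom (algebraMap k K)))).obj T ≅ splitTorus K n}
    {ev : Sections T → (Laurent K n →ₐ[K] K)}
    (hmul : ∀ s t x, ev (s * t) (mono x) = ev s (mono x) * ev t (mono x))
    (hev : ∀ s, Spec.map (CommRingCat.ofHom (ev s).toRingHom) ≫ e.inv.left ≫
      Limits.pullback.fst T.hom (Spec.map (CommRingCat.ofHom (algebraMap k K))) =
        Spec.map (CommRingCat.ofHom (algebraMap k K)) ≫ s.left)
    (s t : Sections T) : s * t = t * s := by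
  have hflat : Flat (Spec.map (CommRingCat.ofHom (algebraMap k K))) := by
    rw [Flat.SpecMap_iff]
    change (algebraMap k K).Flat
    rw [RingHom.flat_algebraMap_iff]
    infer_instance
  have hepi : Epi (Spec.map (CommRingCat.ofHom (algebraMap k K))) :=
    Flat.epi_of_flat_of_surjective _
  have h : ev (s * t) = ev (t * s) :=
    laurent_algHom_ext fun i ↦ by rw [hmul, hmul, mul_comm]
  ext1
  refine (cancel_epi (Spec.map (CommRingCat.ofHom (algebraMap k K)))).1 ?_
  refine (hev (s * t)).symm.trans (Eq.trans ?_ (hev (t * s)))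
  rw [h]

end

section

variable {𝒯 : Over (Spec (.of ℤ))} [GrpObj 𝒯] {K : Type} [Field K] [CharZero K] [Algebra ℚ K]
  {n : ℕ}

/-- There are only finitely many integral points of bounded logarithmic coordinates: the regular
functions on `𝒯` take integral values at them, and their `K`-span consists of all Laurent
polynomials. -/
theorem finite_sections_of_logCoord_le [CompactSpace 𝒯.left] [QuasiSeparatedSpace 𝒯.left]
    {e : (Over.pullback (Spec.map (CommRingCat.ofHom (algebraMap ℚ K)))).obj (genericFiber 𝒯) ≅
      splitTorus K n}
    {ev : Sections (genericFiber 𝒯) → (Laurent K n →ₐ[K] K)}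
    (hev : ∀ s, Spec.map (CommRingCat.ofHom (ev s).toRingHom) ≫ e.inv.left ≫
      Limits.pullback.fst (genericFiber 𝒯).hom (Spec.map (CommRingCat.ofHom (algebraMap ℚ K))) =
        Spec.map (CommRingCat.ofHom (algebraMap ℚ K)) ≫ s.left)
    (σ : K →+* ℂ) (B : ℝ) :
    {s : Sections 𝒯 | ‖logCoord σ (ev (toGeneric 𝒯 s))‖ ≤ B}.Finite := by
  let pK := Limits.pullback.fst (genericFiber 𝒯).hom
    (Spec.map (CommRingCat.ofHom (algebraMap ℚ K)))
  let q : Spec (.of (Laurent K n)) ⟶ 𝒯.left :=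
    e.inv.left ≫ pK ≫ Limits.pullback.fst 𝒯.hom specRatToInt
  have hZK : Spec.map (CommRingCat.ofHom (algebraMap ℚ K)) ≫ specRatToInt =
      Spec.map (CommRingCat.ofHom (algebraMap ℤ K)) := hom_specInt_ext _ _
  have hq (s : Sections 𝒯) : Spec.map (CommRingCat.ofHom (ev (toGeneric 𝒯 s)).toRingHom) ≫ q =
      Spec.map (CommRingCat.ofHom (algebraMap ℤ K)) ≫ s.left := by
    have h1 := congrArg (· ≫ Limits.pullback.fst 𝒯.hom specRatToInt) (hev (toGeneric 𝒯 s))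
    simp only [Category.assoc] at h1
    refine h1.trans ?_
    rw [sectionsBaseChange_left_fst specRatToInt 𝒯 s]
    exact (Category.assoc _ _ _).symm.trans (congrArg (· ≫ s.left) hZK)
  have hpull : IsPullback q (Spec.map (CommRingCat.ofHom (algebraMap K (Laurent K n)))) 𝒯.hom
      (Spec.map (CommRingCat.ofHom (algebraMap ℤ K))) := by
    have h1 : IsPullback (pK ≫ Limits.pullback.fst 𝒯.hom specRatToInt)
        (Limits.pullback.snd _ _) 𝒯.hom
        (Spec.map (CommRingCat.ofHom (algebraMap ℚ K)) ≫ specRatToInt) :=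
      (IsPullback.of_hasPullback (genericFiber 𝒯).hom _).paste_horiz
        (IsPullback.of_hasPullback 𝒯.hom specRatToInt)
    rw [hZK] at h1
    have : IsIso e.inv.left := inferInstanceAs (IsIso ((Over.forget _).map e.inv))
    have h2 : IsPullback e.inv.left (Spec.map (CommRingCat.ofHom (algebraMap K (Laurent K n))))
        (Limits.pullback.snd (genericFiber 𝒯).hom
          (Spec.map (CommRingCat.ofHom (algebraMap ℚ K)))) (𝟙 (Spec (.of K))) :=
      IsPullback.of_horiz_isIso ⟨(Over.w e.inv).trans (Category.comp_id _).symm⟩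
    have h3 := h2.paste_horiz h1
    rwa [Category.id_comp] at h3
  have hspan := span_range_appTop_eq_top 𝒯.hom hpull
  let ρ := (q.appTop ≫ (Scheme.ΓSpecIso (.of (Laurent K n))).hom).hom
  have hint (s : Sections 𝒯) (b : Γ(𝒯.left, ⊤)) : ∃ m : ℤ, ev (toGeneric 𝒯 s) (ρ b) = m := by
    refine ⟨(s.left.appTop ≫ (Scheme.ΓSpecIso (.of ℤ)).hom).hom b, ?_⟩
    have h1 : (q.appTop ≫ (Scheme.ΓSpecIso (.of (Laurent K n))).hom) ≫
        CommRingCat.ofHom (ev (toGeneric 𝒯 s)).toRingHom =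
        (s.left.appTop ≫ (Scheme.ΓSpecIso (.of ℤ)).hom) ≫
          CommRingCat.ofHom (algebraMap ℤ K) := by
      have h2 := congrArg (fun f ↦ Scheme.Hom.appTop f ≫ (Scheme.ΓSpecIso (.of K)).hom) (hq s)
      simp only [Scheme.Hom.comp_appTop, Category.assoc] at h2
      rw [Category.assoc, ← Scheme.ΓSpecIso_naturality]
      refine h2.trans ?_
      rw [Scheme.ΓSpecIso_naturality]
      exact (Category.assoc _ _ _).symm
    exact (congrArg (fun f ↦ f.hom b) h1).trans (eq_intCast (algebraMap ℤ K) _)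
  refine ((finite_bounded_algHoms ρ hspan σ B).preimage'
    (f := fun s : Sections 𝒯 ↦ ev (toGeneric 𝒯 s)) fun f _ ↦ ?_).subset fun s hs ↦ ⟨hint s, hs⟩
  refine Set.Finite.subset ((finite_sections_over_point K
    (Spec.map (CommRingCat.ofHom f.toRingHom) ≫ q)).preimage
    (f := fun s : Sections 𝒯 ↦ s.left) fun s _ t _ hst ↦ Over.OverMorphism.ext hst) ?_
  rintro s rfl
  exact (hq s).symm

end

/-! ### Ranks of groups of integral sections -/

theorem fg_and_rk_subgroup_of_finite_preimages {G G' : Type*} [Group G] [Group G'] {E : Type*}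
    [NormedAddCommGroup E] [NormedSpace ℝ E] [FiniteDimensional ℝ E] (f : G →* G')
    (L : G' →* Multiplicative E) (h : ∀ B : ℝ, {g | ‖(L (f g)).toAdd‖ ≤ B}.Finite)
    {Δ : Subgroup G'} (hΔ : Δ ≤ f.range) :
    Δ.FG ∧ rk Δ =
      Module.finrank ℝ (Submodule.span ℝ ((fun g ↦ (L g).toAdd) '' (Δ : Set G'))) := by
  have hfin (B : ℝ) : {g : Δ | ‖(L.comp Δ.subtype g).toAdd‖ ≤ B}.Finite := by
    refine (((h B).image f).preimage Subtype.val_injective.injOn).subset fun g hg ↦ ?_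
    obtain ⟨x, hx⟩ := hΔ g.2
    have hg' : ‖(L g).toAdd‖ ≤ B := hg
    exact ⟨x, by rwa [← hx] at hg', hx⟩
  obtain ⟨h1, h2⟩ := fg_and_rk_of_finite_preimages (L.comp Δ.subtype) hfin
  refine ⟨(Group.fg_iff_subgroup_fg Δ).1 h1, h2.trans ?_⟩
  have : (Set.range fun g ↦ (L.comp Δ.subtype g).toAdd) =
      (fun g ↦ (L g).toAdd) '' (Δ : Set G') := by
    rw [Set.image_eq_range]; rfl
  rw [this]

theorem rk_subgroup_of_finite_preimages {G G' : Type*} [Group G] [Group G'] {E : Type*}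
    [NormedAddCommGroup E] [NormedSpace ℝ E] [FiniteDimensional ℝ E] (f : G →* G')
    (L : G' →* Multiplicative E) (h : ∀ B : ℝ, {g | ‖(L (f g)).toAdd‖ ≤ B}.Finite)
    (Γ : Subgroup G) : rk Γ = rk (Γ.map f) := by
  have h1 := (fg_and_rk_of_finite_preimages ((L.comp f).comp Γ.subtype) fun B ↦
    (h B).preimage Subtype.val_injective.injOn).2
  rw [h1, (fg_and_rk_subgroup_of_finite_preimages f L h (Subgroup.map_le_range f Γ)).2]
  have : (Set.range fun g ↦ (((L.comp f).comp Γ.subtype) g).toAdd) =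
      (fun g ↦ (L g).toAdd) '' (Γ.map f : Set G') := by
    rw [Subgroup.coe_map, Set.image_image, Set.image_eq_range]; rfl
  rw [this]

/-- The generic point of `Spec ℤ` is dense, so it determines a section if `𝒯` is separated. -/
theorem toGeneric_injective (𝒯 : Over (Spec (.of ℤ))) [GrpObj 𝒯] [IsSeparated 𝒯.hom] :
    Function.Injective (toGeneric 𝒯) := by
  have hdom : IsDominant specRatToInt := by
    rw [isDominant_iff]
    refine dense_iff_inter_open.2 fun W hW hne ↦ ?_
    let o : Spec (.of ℚ) := IsLocalRing.closedPoint ℚ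
    exact ⟨specRatToInt o, by
      rw [specMap_int_apply]
      exact genericPoint_mem_of_nonempty ⟨W, hW⟩ hne, o, rfl⟩
  intro s t hst
  ext1
  refine ext_of_isDominant_of_isSeparated (X := Spec (.of ℤ)) 𝒯.hom (hom_specInt_ext _ _)
    specRatToInt ?_
  rw [← sectionsBaseChange_left_fst, ← sectionsBaseChange_left_fst]
  exact congrArg (fun u ↦ u.left ≫ Limits.pullback.fst 𝒯.hom specRatToInt) hst

theorem rk_eq_zero_of_subsingleton (G : Type*) [Group G] [Subsingleton G] : rk G = 0 := by
  have : Subsingleton (Abelianization G) :=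
    (QuotientGroup.mk'_surjective (commutator G)).subsingleton
  have : Subsingleton (Additive (Abelianization G)) := this
  exact Module.finrank_zero_of_subsingleton

/-- If the rational points of every closed subgroup scheme meet `Γ` in a group of rank at most the
dimension of the subgroup scheme, then the infimum defining `d(G, Γ)` is attained by the
trivial subgroup. -/
theorem d_eq_rk (G : Over (Spec (.of ℚ))) [GrpObj G] (Γ : Subgroup (Sections G))
    (h : ∀ (H : Over (Spec (.of ℚ))) [GrpObj H] (i : H ⟶ G) [IsMonHom i],
      IsClosedImmersion i.left →
      (rk ↥(Γ ⊓ (IsMonHom.monoidHom i (𝟙_ (Over (Spec (.of ℚ))))).range) : WithBot ℕ∞) ≤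
        topologicalKrullDim H.left) :
    d G Γ = rk Γ := by
  refine IsLeast.csInf_eq ⟨⟨𝟙_ _, inferInstance, η[G], inferInstance, inferInstance, ?_⟩, ?_⟩
  · have hdim : topologicalKrullDim (𝟙_ (Over (Spec (.of ℚ)))).left = 0 :=
      (PrimeSpectrum.topologicalKrullDim_eq_ringKrullDim ℚ).trans (ringKrullDim_eq_zero_of_field ℚ)
    have hsub : Subsingleton ↥(Γ ⊓ (IsMonHom.monoidHom η[G] (𝟙_ (Over (Spec (.of ℚ))))).range) := by
      refine ⟨fun ⟨x, hx⟩ ⟨y, hy⟩ ↦ Subtype.ext ?_⟩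
      obtain ⟨a, rfl⟩ := hx.2
      obtain ⟨b, rfl⟩ := hy.2
      exact congrArg (IsMonHom.monoidHom η[G] _) (toUnit_unique a b)
    rw [hdim, rk_eq_zero_of_subsingleton (G := ↥(Γ ⊓ _)), zero_add, add_zero]
  · rintro m ⟨H, _, i, _, hi, hm⟩
    have h1 := add_le_add_left (h H i hi) (rk Γ : WithBot ℕ∞)
    rw [← hm] at h1
    have h2 : rk ↥(Γ ⊓ (IsMonHom.monoidHom i (𝟙_ (Over (Spec (.of ℚ))))).range) + rk Γ ≤
        m + rk ↥(Γ ⊓ (IsMonHom.monoidHom i (𝟙_ (Over (Spec (.of ℚ))))).range) := by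
      exact_mod_cast h1
    omega

end TorusRank

theorem mainTheorem2 (𝒯 : Over (Spec (.of ℤ))) [GrpObj 𝒯]
    [LocallyOfFiniteType 𝒯.hom] [QuasiCompact 𝒯.hom]
    (hT : TorusRank.IsTorus (TorusRank.genericFiber 𝒯)) :
    (Group.FG (TorusRank.Sections 𝒯) ∧
      (IsSeparated 𝒯.hom → (∀ x y : TorusRank.Sections 𝒯, x * y = y * x) ∧
        Function.Injective (TorusRank.toGeneric 𝒯))) ∧
    (TorusRank.rk (TorusRank.Sections 𝒯) : WithBot ℕ∞) ≤
      topologicalKrullDim (TorusRank.genericFiber 𝒯).left ∧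
    ∀ Γ : Subgroup (TorusRank.Sections 𝒯),
      (Γ.map (TorusRank.toGeneric 𝒯)).FG ∧
      (∀ (p : ℕ) [Fact p.Prime], ∀ x ∈ Γ.map (TorusRank.toGeneric 𝒯),
        x ∈ TorusRank.finitePart (TorusRank.genericFiber 𝒯) p) ∧
      TorusRank.d (TorusRank.genericFiber 𝒯) (Γ.map (TorusRank.toGeneric 𝒯)) =
        TorusRank.rk Γ := by
  obtain ⟨n, e, he⟩ := hT
  obtain ⟨ev, hmul, hev⟩ := TorusRank.exists_eval (TorusRank.genericFiber 𝒯) e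
  -- Stated for a general field to avoid the second `ℚ`-algebra structure on `AlgebraicClosure ℚ`
  -- that comes from characteristic zero.
  have hemb (k : Type) [Field k] [Algebra k ℂ] : Nonempty (AlgebraicClosure k →+* ℂ) :=
    ⟨(IsAlgClosed.lift (R := k) (M := ℂ)).toRingHom⟩
  obtain ⟨σ⟩ := hemb ℚ
  let L := TorusRank.logMap ev hmul σ
  have hcomp : CompactSpace 𝒯.left :=
    QuasiCompact.compactSpace_of_compactSpace (Y := Spec (.of ℤ)) 𝒯.hom
  have hqs : QuasiSeparatedSpace 𝒯.left := by
    have : IsLocallyNoetherian 𝒯.left :=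
      LocallyOfFiniteType.isLocallyNoetherian (Y := Spec (.of ℤ)) 𝒯.hom
    exact IsLocallyNoetherian.quasiSeparatedSpace
  have hfin (B : ℝ) : {s | ‖(L (TorusRank.toGeneric 𝒯 s)).toAdd‖ ≤ B}.Finite :=
    TorusRank.finite_sections_of_logCoord_le hev σ B
  have hrk := TorusRank.rk_subgroup_of_finite_preimages _ L hfin
  have hdim {H : Over (Spec (.of ℚ))} (i : H ⟶ TorusRank.genericFiber 𝒯)
      (hi : IsClosedImmersion i.left)
      (Δ : Subgroup (TorusRank.Sections (TorusRank.genericFiber 𝒯)))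
      (hΔ : Δ ≤ (TorusRank.toGeneric 𝒯).range)
      (hΔi : ∀ s ∈ Δ, ∃ t : TorusRank.Sections H, t ≫ i = s) :
      (TorusRank.rk Δ : WithBot ℕ∞) ≤ topologicalKrullDim H.left := by
    rw [(TorusRank.fg_and_rk_subgroup_of_finite_preimages _ L hfin hΔ).2]
    exact TorusRank.finrank_span_logCoord_le hmul hev σ i Δ hΔi
  refine ⟨⟨?_, fun hsep ↦ ?_⟩, ?_, fun Γ ↦ ⟨?_, ?_, ?_⟩⟩
  · exact (TorusRank.fg_and_rk_of_finite_preimages (L.comp (TorusRank.toGeneric 𝒯)) hfin).1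
  · have hinj := TorusRank.toGeneric_injective 𝒯
    refine ⟨fun x y ↦ hinj ?_, hinj⟩
    rw [map_mul, map_mul, TorusRank.mul_comm_of_eval hmul hev]
  · rw [(TorusRank.fg_and_rk_of_finite_preimages (L.comp (TorusRank.toGeneric 𝒯)) hfin).2]
    have : IsClosedImmersion (𝟙 (TorusRank.genericFiber 𝒯) : _ ⟶ _).left :=
      inferInstanceAs (IsClosedImmersion (𝟙 (TorusRank.genericFiber 𝒯).left))
    have h := TorusRank.finrank_span_logCoord_le hmul hev σ (𝟙 (TorusRank.genericFiber 𝒯))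
      (TorusRank.toGeneric 𝒯).range fun s _ ↦ ⟨s, Category.comp_id s⟩
    rw [MonoidHom.coe_range, ← Set.range_comp] at h
    exact h
  · exact (TorusRank.fg_and_rk_subgroup_of_finite_preimages _ L hfin
      (Subgroup.map_le_range _ Γ)).1
  · rintro p _ _ ⟨s, -, rfl⟩
    exact TorusRank.toGeneric_mem_finitePart p s
  · rw [hrk Γ]
    refine TorusRank.d_eq_rk _ _ fun H _ i _ hi ↦ hdim i hi _
      (inf_le_left.trans (Subgroup.map_le_range _ Γ)) ?_
    rintro s ⟨-, t, rfl⟩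
    exact ⟨t, rfl⟩
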